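/- Fix a finite alphabet $A$ (for theories with visibly pushdown constraints, also a partition of $A$ into call, internal and return letters). A *string theory* over $A$ consists of the quantifier-free formulas (closed under $\neg,\wedge,\vee,\Rightarrow,\Leftrightarrow$) over word variables built from atoms of some of the following types: membership constraints $s\in L$, where $L$ is given by an automaton and is a regular language (REG), a visibly pushdown language for the fixed partition (VPL), or a deterministic context-free language (CF); linear equalities with integer coefficients between lengths of variables and constant words (LEN); word equations $s=s'$ (WE). When word equations are allowed, all string terms $s,s'$ are arbitrary concatenations of variables and letters. A *family* of theories is obtained by fixing the available atom types, and the class of languages for membership constraints, and letting $A$ vary. Let $\mathfrak F$ be a family containing WE+REG, that is, one of WE+REG, WE+REG+LEN, WE+VPL, WE+VPL+LEN, WE+CF, WE+CF+LEN. The language expressed by a variable $x$ occurring in a formula $f$ is the set of all words $w\in A^*$ such that some satisfying assignment of $f$ maps $x$ to $w$; the pair $(f,x)$ is a description of this language. **Theorem.** There is $N$ such that for every alphabet $A$ with $|A|\ge N$ (and every partition of $A$), every letter $\#\in A$, and $\Sigma=A\setminus\{\#\}$, the class $\mathcal C$ of languages expressible in the theory of $\mathfrak F$ over $A=\Sigma\cup\{\#\}$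 satisfies the hypotheses that Greibach's theorem places on the class $\mathcal C$: 1. every language in $\mathcal C$ has a finite description, and $\mathcal C$ contains every regular language over $A$; 2. there are algorithms which, given descriptions of $L_1,L_2\in\mathcal C$, compute a description of $L_1\cup L_2$, and, given a description of $L\in\mathcal C$ and a finite automaton for a regular language $R\subseteq A^*$, compute descriptions of $LR$ and of $RL$; 3. it is undecidable, given a description of $L\in\mathcal C$, whether $L=\Sigma^*$. -/

import Mathlib

/-! ### Automata, given by finite tables -/

/-- A nondeterministic finite automaton, given by a finite table. States are natural numbers; only
the finitely many states that occur in the table are relevant. An entry `(q, a, p)` of `trans` is a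
transition from `q` to `p` reading `a`. -/
structure NFATable (α : Type) where
  trans : List (ℕ × α × ℕ)
  start : List ℕ
  accept : List ℕ

/-- The table as an automaton in the sense of Mathlib. -/
def NFATable.toNFA {α : Type} (M : NFATable α) : NFA α ℕ where
  step q a := {p | (q, a, p) ∈ M.trans}
  start := {q | q ∈ M.start}
  accept := {q | q ∈ M.accept}

/-- The regular language accepted by the automaton. -/
def NFATable.lang {α : Type} (M : NFATable α) : Language α := M.toNFA.accepts

/-- The three parts of a pushdown alphabet. -/
inductive LetterKind where
  | call
  | internal
  | ret

/-- A (nondeterministic) visibly pushdown automaton, given by finite tables. States and stack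
symbols are natural numbers.
* `(q, a, p, γ) ∈ call`: in state `q`, read the call letter `a`, go to `p`, push `γ`;
* `(q, a, p) ∈ internal`: in state `q`, read the internal letter `a`, go to `p`;
* `(q, a, some γ, p) ∈ ret`: in state `q` with `γ` on top of the stack, read the return letter `a`,
  pop `γ`, go to `p`;
* `(q, a, none, p) ∈ ret`: in state `q` with empty stack, read the return letter `a`, go to `p`.
Entries whose letter is of the wrong kind are never used. -/
structure VPATable (α : Type) where
  call : List (ℕ × α × ℕ × ℕ)
  internal : List (ℕ × α × ℕ)
  ret : List (ℕ × α × Option ℕ × ℕ)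
  start : List ℕ
  accept : List ℕ

/-- One step of a visibly pushdown automaton on the letter `a`. A configuration is a state together
with a stack, whose top is the head of the list. `kind` is the partition of the alphabet. -/
def VPATable.Step {α : Type} (kind : α → LetterKind) (M : VPATable α) (a : α)
    (c c' : ℕ × List ℕ) : Prop :=
  match kind a with
  | .call => ∃ γ, (c.1, a, c'.1, γ) ∈ M.call ∧ c'.2 = γ :: c.2
  | .internal => (c.1, a, c'.1) ∈ M.internal ∧ c'.2 = c.2
  | .ret => (∃ γ, (c.1, a, some γ, c'.1) ∈ M.ret ∧ c.2 = γ :: c'.2) ∨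
      ((c.1, a, none, c'.1) ∈ M.ret ∧ c.2 = [] ∧ c'.2 = [])

/-- The transition system of a visibly pushdown automaton on its (infinitely many) configurations;
it starts with the empty stack and accepts by final state, with any stack. -/
def VPATable.configurations {α : Type} (kind : α → LetterKind) (M : VPATable α) :
    NFA α (ℕ × List ℕ) where
  step c a := {c' | M.Step kind a c c'}
  start := {c | c.1 ∈ M.start ∧ c.2 = []}
  accept := {c | c.1 ∈ M.accept}

/-- The visibly pushdown language accepted by the automaton. -/
def VPATable.lang {α : Type} (kind : α → LetterKind) (M : VPATable α) : Language α :=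
  (M.configurations kind).accepts

/-- A deterministic pushdown automaton (with `ε`-moves), given by a finite table. An entry
`(q, a, Z, p, γ)` of `trans` means: in state `q` with `Z` on top of the stack, read the letter `a`
(nothing if `a = none`), go to state `p` and replace `Z` by the word `γ`. Determinism: at most one
move for each `q`, `a`, `Z`, and an `ε`-move for `q`, `Z` excludes every other move for `q`, `Z`. -/
structure DPDATable (α : Type) where
  trans : List (ℕ × Option α × ℕ × ℕ × List ℕ)
  start : ℕ
  bottom : ℕ
  accept : List ℕ
  deterministic : ∀ q Z a b p p' γ γ', (q, a, Z, p, γ) ∈ trans → (q, b, Z, p', γ') ∈ trans →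
    (a = b ∨ a = none) → a = b ∧ p = p' ∧ γ = γ'

/-- One move of a pushdown automaton. A configuration consists of the state, the input not yet read,
and the stack, whose top is the head of the list. -/
def DPDATable.Step {α : Type} (M : DPDATable α) (c c' : ℕ × List α × List ℕ) : Prop :=
  ∃ (a : Option α) (Z : ℕ) (γ s : List ℕ), (c.1, a, Z, c'.1, γ) ∈ M.trans ∧
    c.2.1 = a.toList ++ c'.2.1 ∧ c.2.2 = Z :: s ∧ c'.2.2 = γ ++ s

/-- The deterministic context-free language accepted by the automaton (by final state). -/
def DPDATable.lang {α : Type} (M : DPDATable α) : Language α :=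
  {w | ∃ q ∈ M.accept, ∃ s : List ℕ,
    Relation.ReflTransGen M.Step (M.start, w, [M.bottom]) (q, [], s)}

/-! ### Formulas -/

/-- The classes of languages that may be permitted in membership constraints. -/
inductive LangClass where
  | reg
  | vpl
  | cf

/-- Descriptions of languages in membership constraints. -/
inductive LangDesc (α : Type) where
  | nfa (M : NFATable α)
  | vpa (M : VPATable α)
  | dpda (M : DPDATable α)

def LangDesc.cls {α : Type} : LangDesc α → LangClass
  | .nfa _ => .reg
  | .vpa _ => .vpl
  | .dpda _ => .cf

def LangDesc.lang {α : Type} (kind : α → LetterKind) : LangDesc α → Language α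
  | .nfa M => M.lang
  | .vpa M => M.lang kind
  | .dpda M => M.lang

/-- Basic string terms: a variable (variables are natural numbers) or a constant word. -/
abbrev BasicTerm (α : Type) : Type := ℕ ⊕ List α

/-- Extended string terms: concatenations of variables and letters. -/
abbrev StrTerm (α : Type) : Type := List (ℕ ⊕ α)

/-- Length terms `k₀ + k₁ |s₁| + ⋯ + kₙ |sₙ|` with integers `kᵢ` and basic string terms `sᵢ`. -/
abbrev LenTerm (α : Type) : Type := ℤ × List (ℤ × BasicTerm α)

def BasicTerm.eval {α : Type} (h : ℕ → List α) : BasicTerm α → List α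
  | .inl x => h x
  | .inr w => w

/-- The image of a string term under the substitution `h` of words for variables. -/
def StrTerm.eval {α : Type} (h : ℕ → List α) (s : StrTerm α) : List α :=
  s.flatMap (Sum.elim h (fun a => [a]))

/-- The string term is a basic one: a single variable, or a constant word. -/
def StrTerm.IsBasic {α : Type} (s : StrTerm α) : Prop :=
  (∃ x : ℕ, s = [Sum.inl x]) ∨ ∃ w : List α, s = w.map Sum.inr

def LenTerm.eval {α : Type} (h : ℕ → List α) (l : LenTerm α) : ℤ :=
  l.1 + (l.2.map (fun t => t.1 * ((BasicTerm.eval h t.2).length : ℤ))).sum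

/-- Atoms: language membership constraints `s ∈ L`, length constraints `l₁ = l₂`, and word
equations `s₁ = s₂`. -/
inductive Atom (α : Type) where
  | mem (s : StrTerm α) (L : LangDesc α)
  | len (l₁ l₂ : LenTerm α)
  | eqn (s₁ s₂ : StrTerm α)

def Atom.Holds {α : Type} (kind : α → LetterKind) (h : ℕ → List α) : Atom α → Prop
  | .mem s L => StrTerm.eval h s ∈ L.lang kind
  | .len l₁ l₂ => LenTerm.eval h l₁ = LenTerm.eval h l₂
  | .eqn s₁ s₂ => StrTerm.eval h s₁ = StrTerm.eval h s₂

/-- The variable `x` occurs in the atom. -/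
def Atom.Occurs {α : Type} (x : ℕ) : Atom α → Prop
  | .mem s _ => Sum.inl x ∈ s
  | .len l₁ l₂ => ∃ k : ℤ, (k, Sum.inl x) ∈ l₁.2 ∨ (k, Sum.inl x) ∈ l₂.2
  | .eqn s₁ s₂ => Sum.inl x ∈ s₁ ∨ Sum.inl x ∈ s₂

/-- Quantifier-free formulas. -/
inductive StrFormula (α : Type) where
  | atom (A : Atom α)
  | neg (f : StrFormula α)
  | and (f g : StrFormula α)
  | or (f g : StrFormula α)
  | imp (f g : StrFormula α)
  | iff (f g : StrFormula α)

def StrFormula.Holds {α : Type} (kind : α → LetterKind) (h : ℕ → List α) : StrFormula α → Prop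
  | .atom A => A.Holds kind h
  | .neg f => ¬ f.Holds kind h
  | .and f g => f.Holds kind h ∧ g.Holds kind h
  | .or f g => f.Holds kind h ∨ g.Holds kind h
  | .imp f g => f.Holds kind h → g.Holds kind h
  | .iff f g => (f.Holds kind h ↔ g.Holds kind h)

def StrFormula.Occurs {α : Type} (x : ℕ) : StrFormula α → Prop
  | .atom A => A.Occurs x
  | .neg f => f.Occurs x
  | .and f g | .or f g | .imp f g | .iff f g => f.Occurs x ∨ g.Occurs x

/-- All atoms of the formula satisfy `P`. -/
def StrFormula.AllAtoms {α : Type} (P : Atom α → Prop) : StrFormula α → Prop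
  | .atom A => P A
  | .neg f => f.AllAtoms P
  | .and f g | .or f g | .imp f g | .iff f g => f.AllAtoms P ∧ g.AllAtoms P

/-! ### The twenty families of theories -/

/-- What is allowed on string terms: only basic terms; concatenation (`CON`); concatenation and
word equations (`WE`). -/
inductive StrLevel where
  | basic
  | con
  | we

/-- A family of theories: the class of languages permitted in membership constraints (`none` if
there are no such constraints), whether length constraints are allowed, and the level of the string
terms. Theories with neither membership constraints nor word equations are excluded, which leaves
exactly twenty families. -/
structure TheoryFamily where
  member : Option LangClass
  len : Bool
  str : StrLevel
  stringBased : member ≠ none ∨ str = StrLevel.we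

def LangClass.rank : LangClass → ℕ
  | .reg => 0
  | .vpl => 1
  | .cf => 2

def StrLevel.rank : StrLevel → ℕ
  | .basic => 0
  | .con => 1
  | .we => 2

/-- The family `F` contains the family `G`: every kind of constraint of `G` is available in `F`
(regular languages are visibly pushdown languages, which are deterministic context-free). -/
def TheoryFamily.Contains (F G : TheoryFamily) : Prop :=
  (∀ c, G.member = some c → ∃ c', F.member = some c' ∧ c.rank ≤ c'.rank) ∧
  (G.len = true → F.len = true) ∧ G.str.rank ≤ F.str.rank

/-- The family `WE + REG`. -/
def TheoryFamily.weReg : TheoryFamily where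
  member := some .reg
  len := false
  str := .we
  stringBased := Or.inr rfl

/-- The atoms that are available in the theories of the family `F`. -/
def TheoryFamily.Allows {α : Type} (F : TheoryFamily) : Atom α → Prop
  | .mem s L => F.member = some L.cls ∧ (F.str = .basic → s.IsBasic)
  | .len _ _ => F.len = true
  | .eqn _ _ => F.str = .we

/-- The theory of the family `F` with underlying alphabet `α`, as a set of formulas. -/
def TheoryFamily.theory (F : TheoryFamily) (α : Type) : Set (StrFormula α) :=
  {f | f.AllAtoms F.Allows}

/-- Descriptions of the languages expressible in a theory: a formula of the theory together with a
variable that occurs in it. -/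
structure Description (F : TheoryFamily) (α : Type) where
  formula : StrFormula α
  mem_theory : formula ∈ F.theory α
  var : ℕ
  occurs : formula.Occurs var

/-- The language expressed by the variable in the formula. -/
def Description.lang {F : TheoryFamily} {α : Type} (kind : α → LetterKind)
    (d : Description F α) : Language α :=
  {w | ∃ h : ℕ → List α, d.formula.Holds kind h ∧ h d.var = w}

/-! ### Coding of descriptions by finite data

Formulas are coded by writing them in prefix notation, as lists of tokens. -/

abbrev NFACode (α : Type) : Type := List (ℕ × α × ℕ) × List ℕ × List ℕ

abbrev VPACode (α : Type) : Type :=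
  List (ℕ × α × ℕ × ℕ) × List (ℕ × α × ℕ) × List (ℕ × α × Option ℕ × ℕ) × List ℕ × List ℕ

abbrev DPDACode (α : Type) : Type :=
  List (ℕ × Option α × ℕ × ℕ × List ℕ) × ℕ × ℕ × List ℕ

abbrev LangCode (α : Type) : Type := NFACode α ⊕ VPACode α ⊕ DPDACode α

abbrev AtomCode (α : Type) : Type :=
  (StrTerm α × LangCode α) ⊕ (LenTerm α × LenTerm α) ⊕ (StrTerm α × StrTerm α)

/-- A token is an atom or one of the five connectives. -/
abbrev Token (α : Type) : Type := AtomCode α ⊕ Fin 5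

abbrev DescriptionCode (α : Type) : Type := List (Token α) × ℕ

/-! Shortcuts for the standard Mathlib instances on these sums, products and lists. -/

instance instPrimcodableLangCode {α : Type} [Primcodable α] : Primcodable (LangCode α) :=
  @Primcodable.sum (NFACode α) (VPACode α ⊕ DPDACode α) inferInstance inferInstance

instance instPrimcodableAtomCode {α : Type} [Primcodable α] : Primcodable (AtomCode α) :=
  @Primcodable.sum (StrTerm α × LangCode α) ((LenTerm α × LenTerm α) ⊕ (StrTerm α × StrTerm α))
    inferInstance inferInstance

instance instPrimcodableToken {α : Type} [Primcodable α] : Primcodable (Token α) :=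
  @Primcodable.sum (AtomCode α) (Fin 5) inferInstance inferInstance

def NFATable.code {α : Type} (M : NFATable α) : NFACode α := (M.trans, M.start, M.accept)

def VPATable.code {α : Type} (M : VPATable α) : VPACode α :=
  (M.call, M.internal, M.ret, M.start, M.accept)

def DPDATable.code {α : Type} (M : DPDATable α) : DPDACode α :=
  (M.trans, M.start, M.bottom, M.accept)

def LangDesc.code {α : Type} : LangDesc α → LangCode α
  | .nfa M => .inl M.code
  | .vpa M => .inr (.inl M.code)
  | .dpda M => .inr (.inr M.code)

def Atom.code {α : Type} : Atom α → AtomCode α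
  | .mem s L => .inl (s, L.code)
  | .len l₁ l₂ => .inr (.inl (l₁, l₂))
  | .eqn s₁ s₂ => .inr (.inr (s₁, s₂))

def StrFormula.code {α : Type} : StrFormula α → List (Token α)
  | .atom A => [.inl A.code]
  | .neg f => .inr 0 :: f.code
  | .and f g => .inr 1 :: (f.code ++ g.code)
  | .or f g => .inr 2 :: (f.code ++ g.code)
  | .imp f g => .inr 3 :: (f.code ++ g.code)
  | .iff f g => .inr 4 :: (f.code ++ g.code)

def Description.code {F : TheoryFamily} {α : Type} (d : Description F α) : DescriptionCode α :=
  (d.formula.code, d.var)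

/-! ### The hypotheses of Greibach's theorem -/

/-- The hypotheses that Greibach's theorem makes on a class `𝒞` of languages over an alphabet `α`
with a distinguished letter `hash` (so that `α` is `Σ ∪ {#}`). The class consists of the languages
`lang d` of the descriptions `d : D`; descriptions are coded by elements of `T`, and algorithms work
on these codes. In `Language α`, `+` is union and `*` is concatenation. -/
structure GreibachConditions {α D T : Type} [Primcodable α] [Primcodable T]
    (lang : D → Language α) (code : D → T) (hash : α) : Prop where
  /-- Descriptions are finite objects, determined by their codes. -/
  finite_descriptions : Function.Injective code
  /-- All regular languages over `α` belong to the class. -/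
  regular : ∀ R : Language α, R.IsRegular → ∃ d, lang d = R
  /-- From descriptions of `L₁` and `L₂` one can compute one of `L₁ ∪ L₂`. -/
  union : ∃ G : T → T → T, Computable₂ G ∧
    ∀ d₁ d₂, ∃ d, G (code d₁) (code d₂) = code d ∧ lang d = lang d₁ + lang d₂
  /-- From a description of `L` and an automaton for `R` one can compute a description of `L R`. -/
  mul_regular : ∃ G : T → NFACode α → T, Computable₂ G ∧
    ∀ d (M : NFATable α), ∃ d', G (code d) M.code = code d' ∧ lang d' = lang d * M.lang
  /-- From a description of `L` and an automaton for `R` one can compute a description of `R L`. -/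
  regular_mul : ∃ G : T → NFACode α → T, Computable₂ G ∧
    ∀ d (M : NFATable α), ∃ d', G (code d) M.code = code d' ∧ lang d' = M.lang * lang d
  /-- It is undecidable whether `L = (α ∖ {hash})*`. -/
  universality_undecidable : ¬ ∃ dec : T → Bool, Computable dec ∧
    ∀ d, dec (code d) = true ↔ lang d = {w : List α | hash ∉ w}

/-! The variables of a formula are read existentially. Hence a union is a disjunction. A product
with a regular language is a word equation between the product, the old variable and a new variable
constrained to the regular language. Membership atoms must belong to the one class that the family
permits, so a finite automaton is first turned, computably, into a visibly pushdown automaton that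
only pushes a constant symbol, or into a deterministic one by the subset construction
(`NFATable.lang_toLangDesc`, `NFACode.primrec_toLangCode`). Formulas are coded in prefix notation,
so assembling and renaming them are list operations.

For undecidability, fix a program `c` with undecidable halting problem. From `m` one computes a
description of the words without `hash` that do not certify that `c` halts on `m`; it is universal
if and only if `c` diverges on `m` (`Description.universality_undecidable`). Since non-certificates
are described existentially, being a certificate must be expressible with universally quantified
auxiliary words only (`UDef`). Existence still enters through `UDef.split`: the splitting of a word
at the first occurrence of a letter is unique, so "some splitting" and "every splitting" agree once
the letter occurs.

Certificates are built by recursion on `c` (`exists_checkable_codeGraph`). Certificates of a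
conjunction are joined by a fresh separator, existential witnesses are written into the certificate,
and a loop is certified by a row of its states and step certificates; quantifying over all
factorizations checks every link of the row (`Checkable.reflTransGen`). Each operation costs
boundedly many fresh letters, so the alphabet size needed depends on `c` but not on `m`. Only the
certificates of true instances have to stay within these letters; soundness holds for arbitrary
words. -/

/-! ### Conversions between the kinds of automata -/

/-- A projection of automata that is exact on an invariant set of states preserves runs. -/
theorem NFA.image_evalFrom_of_invariant {α σ τ : Type*} (M : NFA α σ) (N : NFA α τ) (π : σ → τ)
    (I : Set σ) (hI : ∀ s ∈ I, ∀ a, M.step s a ⊆ I)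
    (hstep : ∀ s ∈ I, ∀ a, π '' M.step s a = N.step (π s) a) (x : List α) :
    ∀ S ⊆ I, M.evalFrom S x ⊆ I ∧ π '' M.evalFrom S x = N.evalFrom (π '' S) x := by
  induction x with
  | nil => intro S hS; simpa using hS
  | cons a x ih =>
    intro S hS
    have h1 : M.stepSet S a ⊆ I := by
      intro s hs
      obtain ⟨t, ht, hst⟩ := M.mem_stepSet.1 hs
      exact hI t (hS ht) a hst
    have h2 : π '' M.stepSet S a = N.stepSet (π '' S) a := by
      simp only [NFA.stepSet, Set.image_iUnion₂, Set.biUnion_image]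
      exact Set.iUnion₂_congr fun s hs => hstep s (hS hs) a
    rw [NFA.evalFrom_cons, NFA.evalFrom_cons, ← h2]
    exact ih _ h1

/-- A finite automaton as a visibly pushdown automaton, for any partition of the alphabet. -/
def NFATable.toVPA {α : Type} (M : NFATable α) : VPATable α where
  call := M.trans.map fun t => (t.1, t.2.1, t.2.2, 0)
  internal := M.trans
  ret := M.trans.map (fun t => (t.1, t.2.1, some 0, t.2.2)) ++
    M.trans.map (fun t => (t.1, t.2.1, none, t.2.2))
  start := M.start
  accept := M.accept

/-- Only the symbol 0 is ever pushed, so at a return letter the stack is empty or has 0 on top. The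
table has an entry for both cases, and the stack never blocks a move. -/
theorem NFATable.toVPA_step_fst {α : Type} (kind : α → LetterKind) (M : NFATable α) (a : α)
    (c : ℕ × List ℕ) (hc : ∀ γ ∈ c.2, γ = 0) :
    (∀ c', M.toVPA.Step kind a c c' → (c.1, a, c'.1) ∈ M.trans ∧ ∀ γ ∈ c'.2, γ = 0) ∧
      ∀ q, (c.1, a, q) ∈ M.trans → ∃ s, M.toVPA.Step kind a c (q, s) := by
  obtain ⟨p, s⟩ := c
  constructor
  · rintro ⟨q, s'⟩ h
    unfold VPATable.Step at h
    cases hk : kind a <;> simp [hk, NFATable.toVPA] at h hc ⊢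
    · refine ⟨h.1, ?_⟩
      rw [h.2]
      simpa using hc
    · rw [h.2]
      exact ⟨h.1, hc⟩
    · rcases h with ⟨h1, rfl⟩ | ⟨h1, rfl, rfl⟩
      · exact ⟨h1, fun γ hγ => hc γ (by simp [hγ])⟩
      · simpa using h1
  · intro q h
    unfold VPATable.Step
    cases kind a <;> simp [NFATable.toVPA] at h hc ⊢
    · exact h
    · exact h
    · cases s with
      | nil => exact ⟨[], Or.inr ⟨h, rfl, rfl⟩⟩
      | cons γ s => exact ⟨s, Or.inl ⟨h, by simp [hc γ (by simp)]⟩⟩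

theorem NFATable.toVPA_lang {α : Type} (kind : α → LetterKind) (M : NFATable α) :
    M.toVPA.lang kind = M.lang := by
  have key := NFA.image_evalFrom_of_invariant (M.toVPA.configurations kind) M.toNFA Prod.fst
    {c | ∀ γ ∈ c.2, γ = 0} (fun c hc a c' h => ((M.toVPA_step_fst kind a c hc).1 c' h).2)
    (fun c hc a => by
      ext q
      constructor
      · rintro ⟨c', h, rfl⟩
        exact ((M.toVPA_step_fst kind a c hc).1 c' h).1
      · intro h
        obtain ⟨s, hs⟩ := (M.toVPA_step_fst kind a c hc).2 q h
        exact ⟨(q, s), hs, rfl⟩)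
  have hstart : Prod.fst '' (M.toVPA.configurations kind).start = M.toNFA.start := by
    ext q
    simp [VPATable.configurations, NFATable.toNFA, NFATable.toVPA]
  ext w
  have h := (key w (M.toVPA.configurations kind).start (by
    rintro c ⟨-, hc⟩
    simp [hc])).2
  rw [hstart] at h
  change w ∈ (M.toVPA.configurations kind).accepts ↔ w ∈ M.toNFA.accepts
  rw [NFA.mem_accepts, NFA.mem_accepts, ← h]
  constructor
  · rintro ⟨c, hc, hw⟩
    exact ⟨c.1, hc, c, hw, rfl⟩
  · rintro ⟨_, hq, c, hw, rfl⟩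
    exact ⟨c, hq, hw⟩

/-! The subset construction. -/

/-- A list that contains every state which the automaton may visit. -/
def NFACode.states {α : Type} (c : NFACode α) : List ℕ := c.2.1 ++ c.1.map (·.2.2)

/-- The set of `a`-successors of a set of states, listed in the order of `NFACode.states`. -/
def NFACode.move {α : Type} [DecidableEq α] (c : NFACode α) (S : List ℕ) (a : α) : List ℕ :=
  (NFACode.states c).filter fun p => ∃ t ∈ c.1, t.2.2 = p ∧ t.2.1 = a ∧ ∃ q ∈ S, q = t.1

def NFACode.startSet {α : Type} (c : NFACode α) : List ℕ :=
  (NFACode.states c).filter fun p => ∃ q ∈ c.2.1, q = p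

/-- A set of states is represented by a sublist of `NFACode.states c` in that order, so `sublists'`
lists every set that can arise; its encoding serves as the state number. Repetitions in the list
only repeat identical entries, so determinism is unaffected. -/
def NFACode.subsetConstruction {n : ℕ} (c : NFACode (Fin n)) : DPDACode (Fin n) :=
  ((NFACode.states c).sublists'.flatMap fun S => (List.finRange n).map fun a =>
      (Encodable.encode S, some a, 0, Encodable.encode (NFACode.move c S a), [0]),
    Encodable.encode (NFACode.startSet c), 0,
    ((NFACode.states c).sublists'.filter fun S => ∃ q ∈ S, ∃ p ∈ c.2.2, p = q).map
      Encodable.encode)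

theorem NFACode.mem_move {α : Type} [DecidableEq α] (c : NFACode α) (S : List ℕ) (a : α) (p : ℕ) :
    p ∈ NFACode.move c S a ↔ ∃ q ∈ S, (q, a, p) ∈ c.1 := by
  simp only [NFACode.move, List.mem_filter, decide_eq_true_eq]
  constructor
  · rintro ⟨-, ⟨q, b, p'⟩, ht, rfl, rfl, _, hq, rfl⟩
    exact ⟨_, hq, ht⟩
  · rintro ⟨q, hq, ht⟩
    refine ⟨?_, _, ht, rfl, rfl, q, hq, rfl⟩
    simp only [NFACode.states, List.mem_append, List.mem_map]
    exact Or.inr ⟨_, ht, rfl⟩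

theorem NFACode.move_sublist {α : Type} [DecidableEq α] (c : NFACode α) (S : List ℕ) (a : α) :
    (NFACode.move c S a).Sublist (NFACode.states c) := List.filter_sublist

theorem NFACode.mem_startSet {α : Type} (c : NFACode α) (p : ℕ) :
    p ∈ NFACode.startSet c ↔ p ∈ c.2.1 := by
  simp only [NFACode.startSet, NFACode.states, List.mem_filter, decide_eq_true_eq,
    List.mem_append]
  constructor
  · rintro ⟨-, _, h, rfl⟩
    exact h
  · intro h
    exact ⟨Or.inl h, p, h, rfl⟩

/-- The subset construction, as a deterministic pushdown automaton with constant stack. -/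
def NFATable.toDPDA {n : ℕ} (M : NFATable (Fin n)) : DPDATable (Fin n) where
  trans := (NFACode.subsetConstruction M.code).1
  start := (NFACode.subsetConstruction M.code).2.1
  bottom := (NFACode.subsetConstruction M.code).2.2.1
  accept := (NFACode.subsetConstruction M.code).2.2.2
  deterministic := by
    intro q Z a b p p' γ γ' h h' hab
    simp only [NFACode.subsetConstruction, List.mem_flatMap, List.mem_map, Prod.mk.injEq] at h h'
    obtain ⟨S, -, x, -, rfl, rfl, rfl, rfl, rfl⟩ := h
    obtain ⟨S', -, y, -, hS, rfl, -, rfl, rfl⟩ := h'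
    rw [Encodable.encode_inj] at hS
    subst hS
    simp only [Option.some.injEq, reduceCtorEq, or_false] at hab
    subst hab
    simp

/-- The sublist condition guarantees that the table has a row for `S`; `NFACode.move_sublist`
preserves it along a run. -/
theorem NFATable.toDPDA_step_iff {n : ℕ} (M : NFATable (Fin n)) {S : List ℕ}
    (hS : S.Sublist (NFACode.states M.code)) (w : List (Fin n)) (c : ℕ × List (Fin n) × List ℕ) :
    M.toDPDA.Step (Encodable.encode S, w, [0]) c ↔
      ∃ a v, w = a :: v ∧ c = (Encodable.encode (NFACode.move M.code S a), v, [0]) := by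
  obtain ⟨p, v, s⟩ := c
  simp only [DPDATable.Step, NFATable.toDPDA, NFACode.subsetConstruction, List.mem_flatMap,
    List.mem_map, Prod.mk.injEq, List.mem_sublists']
  constructor
  · rintro ⟨_, _, _, s', ⟨S', -, a, -, hS', rfl, rfl, rfl, rfl⟩, rfl, h, rfl⟩
    rw [Encodable.encode_inj] at hS'
    subst hS'
    simp only [List.cons.injEq, true_and] at h
    subst h
    exact ⟨a, v, rfl, rfl, rfl, rfl⟩
  · rintro ⟨a, v, rfl, rfl, rfl, rfl⟩
    exact ⟨some a, 0, [0], [], ⟨S, hS, a, List.mem_finRange a, rfl, rfl, rfl, rfl, rfl⟩, rfl, rfl,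
      rfl⟩

theorem NFATable.toDPDA_reaches_iff {n : ℕ} (M : NFATable (Fin n)) (q : ℕ) (s : List ℕ)
    (w : List (Fin n)) : ∀ S : List ℕ, S.Sublist (NFACode.states M.code) →
    (Relation.ReflTransGen M.toDPDA.Step (Encodable.encode S, w, [0]) (q, [], s) ↔
      q = Encodable.encode (w.foldl (NFACode.move M.code) S) ∧ s = [0]) := by
  induction w with
  | nil =>
    intro S hS
    constructor
    · intro h
      rcases h.cases_head with h | ⟨c, h, -⟩
      · simp only [Prod.mk.injEq] at h
        exact ⟨h.1.symm, h.2.2.symm⟩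
      · obtain ⟨a, v, h, -⟩ := (M.toDPDA_step_iff hS _ _).1 h
        simp at h
    · rintro ⟨rfl, rfl⟩
      exact .refl
  | cons a w ih =>
    intro S hS
    rw [List.foldl_cons, ← ih _ (NFACode.move_sublist _ S a)]
    constructor
    · intro h
      rcases h.cases_head with h | ⟨c, hs, h'⟩
      · simp at h
      · obtain ⟨b, v, hw, rfl⟩ := (M.toDPDA_step_iff hS _ _).1 hs
        obtain ⟨rfl, rfl⟩ := List.cons.inj hw
        exact h'
    · intro h
      exact .head ((M.toDPDA_step_iff hS _ _).2 ⟨a, w, rfl, rfl⟩) h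

theorem NFATable.mem_foldl_move {n : ℕ} (M : NFATable (Fin n)) (w : List (Fin n)) :
    ∀ S : List ℕ, {q | q ∈ w.foldl (NFACode.move M.code) S} = M.toNFA.evalFrom {q | q ∈ S} w := by
  induction w with
  | nil => simp
  | cons a w ih =>
    intro S
    rw [List.foldl_cons, ih, NFA.evalFrom_cons]
    congr 1
    ext p
    simp only [Set.mem_ofPred_eq, NFACode.mem_move, NFA.mem_stepSet]
    rfl

theorem List.foldl_induction {α β : Type*} {P : β → Prop} {f : β → α → β}
    (hf : ∀ b a, P b → P (f b a)) (l : List α) : ∀ b, P b → P (l.foldl f b) := by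
  induction l with
  | nil => exact fun b hb => hb
  | cons a l ih => exact fun b hb => ih _ (hf b a hb)

theorem NFATable.toDPDA_lang {n : ℕ} (M : NFATable (Fin n)) : M.toDPDA.lang = M.lang := by
  ext w
  have h0 : (NFACode.startSet M.code).Sublist (NFACode.states M.code) := List.filter_sublist
  have h1 : (w.foldl (NFACode.move M.code) (NFACode.startSet M.code)).Sublist
      (NFACode.states M.code) :=
    List.foldl_induction (P := fun S : List ℕ => S.Sublist (NFACode.states M.code))
      (fun S a _ => NFACode.move_sublist _ S a) w _ h0
  have h2 : {q | q ∈ NFACode.startSet M.code} = M.toNFA.start := by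
    ext q
    exact NFACode.mem_startSet M.code q
  have h3 := M.mem_foldl_move w (NFACode.startSet M.code)
  rw [h2] at h3
  change (∃ q ∈ M.toDPDA.accept, ∃ s : List ℕ, Relation.ReflTransGen M.toDPDA.Step
    (Encodable.encode (NFACode.startSet M.code), w, [0]) (q, [], s)) ↔ w ∈ M.toNFA.accepts
  simp only [M.toDPDA_reaches_iff _ _ _ _ h0, NFA.mem_accepts, ← h3]
  simp only [NFATable.toDPDA, NFACode.subsetConstruction, List.mem_map, List.mem_filter,
    List.mem_sublists', decide_eq_true_eq]
  constructor
  · rintro ⟨_, ⟨S, ⟨-, q, hq, p, hp, rfl⟩, rfl⟩, -, hS, -⟩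
    rw [Encodable.encode_inj] at hS
    subst hS
    exact ⟨p, hp, hq⟩
  · rintro ⟨q, hq, hw⟩
    exact ⟨_, ⟨_, ⟨h1, q, hw, q, hq, rfl⟩, rfl⟩, [0], rfl, rfl⟩

/-! The conversions are computable. -/

theorem Primrec.list_sublists' {α : Type*} [Primcodable α] :
    Primrec (List.sublists' : List α → List (List α)) := by
  have h : Primrec₂ fun (_ : List α) (p : α × List (List α)) => p.2 ++ p.2.map (List.cons p.1) :=
    Primrec.list_append.comp (Primrec.snd.comp Primrec.snd)
      (Primrec.list_map (Primrec.snd.comp Primrec.snd)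
        (Primrec.list_cons.comp (Primrec.fst.comp (Primrec.snd.comp Primrec.fst)) Primrec.snd))
  refine (Primrec.list_foldr Primrec.id (Primrec.const [[]]) h).of_eq fun l => ?_
  dsimp only [id]
  induction l with
  | nil => simp
  | cons a l ih => rw [List.foldr_cons, ih, List.sublists'_cons]

section
variable {n : ℕ}

theorem NFACode.primrec_states : Primrec (NFACode.states : NFACode (Fin n) → List ℕ) :=
  Primrec.list_append.comp (Primrec.fst.comp Primrec.snd)
    (Primrec.list_map Primrec.fst (Primrec.snd.comp (Primrec.snd.comp Primrec.snd)))

theorem NFACode.primrec_move : Primrec fun x : NFACode (Fin n) × List ℕ × Fin n =>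
    NFACode.move x.1 x.2.1 x.2.2 := by
  have h1 : PrimrecRel fun (t : ℕ × Fin n × ℕ) (y : ℕ × NFACode (Fin n) × List ℕ × Fin n) =>
      t.2.2 = y.1 ∧ t.2.1 = y.2.2.2 ∧ ∃ q ∈ y.2.2.1, q = t.1 := by
    refine PrimrecPred.and ?_ (PrimrecPred.and ?_ ?_)
    · exact Primrec.eq.comp (Primrec.snd.comp (Primrec.snd.comp Primrec.fst))
        (Primrec.fst.comp Primrec.snd)
    · exact Primrec.eq.comp (Primrec.fst.comp (Primrec.snd.comp Primrec.fst))
        (Primrec.snd.comp (Primrec.snd.comp (Primrec.snd.comp Primrec.snd)))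
    · exact (PrimrecRel.exists_mem_list Primrec.eq).comp
        (Primrec.fst.comp (Primrec.snd.comp (Primrec.snd.comp Primrec.snd)))
        (Primrec.fst.comp Primrec.fst)
  have h2 : PrimrecRel fun (p : ℕ) (x : NFACode (Fin n) × List ℕ × Fin n) =>
      ∃ t ∈ x.1.1, t.2.2 = p ∧ t.2.1 = x.2.2 ∧ ∃ q ∈ x.2.1, q = t.1 :=
    (PrimrecRel.exists_mem_list h1).comp (Primrec.fst.comp (Primrec.fst.comp Primrec.snd))
      Primrec.id
  refine ((PrimrecRel.listFilter h2).comp (NFACode.primrec_states.comp Primrec.fst)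
    Primrec.id).of_eq fun x => ?_
  rfl

theorem NFACode.primrec_startSet : Primrec (NFACode.startSet : NFACode (Fin n) → List ℕ) := by
  have h : PrimrecRel fun (p : ℕ) (c : NFACode (Fin n)) => ∃ q ∈ c.2.1, q = p :=
    (PrimrecRel.exists_mem_list Primrec.eq).comp
      (Primrec.fst.comp (Primrec.snd.comp Primrec.snd)) Primrec.fst
  refine ((PrimrecRel.listFilter h).comp NFACode.primrec_states Primrec.id).of_eq fun x => ?_
  rfl

theorem NFACode.primrec_subsetConstruction :
    Primrec (NFACode.subsetConstruction : NFACode (Fin n) → DPDACode (Fin n)) := by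
  have hsub : Primrec fun c : NFACode (Fin n) => (NFACode.states c).sublists' :=
    Primrec.list_sublists'.comp NFACode.primrec_states
  have hacc : PrimrecRel fun (S : List ℕ) (c : NFACode (Fin n)) =>
      ∃ q ∈ S, ∃ p ∈ c.2.2, p = q := by
    have h : PrimrecRel fun (q : ℕ) (c : NFACode (Fin n)) => ∃ p ∈ c.2.2, p = q :=
      (PrimrecRel.exists_mem_list Primrec.eq).comp
        (Primrec.snd.comp (Primrec.snd.comp Primrec.snd)) Primrec.fst
    exact PrimrecRel.exists_mem_list h
  have hentry : Primrec₂ fun (y : NFACode (Fin n) × List ℕ) (a : Fin n) =>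
      ((Encodable.encode y.2, some a, 0, Encodable.encode (NFACode.move y.1 y.2 a), [0]) :
        ℕ × Option (Fin n) × ℕ × ℕ × List ℕ) := by
    refine Primrec.pair ?_ (Primrec.pair ?_ (Primrec.pair (Primrec.const 0)
      (Primrec.pair ?_ (Primrec.const [0]))))
    · exact Primrec.encode.comp (Primrec.snd.comp Primrec.fst)
    · exact Primrec.option_some.comp Primrec.snd
    · exact Primrec.encode.comp (NFACode.primrec_move.comp (Primrec.pair
        (Primrec.fst.comp Primrec.fst) (Primrec.pair (Primrec.snd.comp Primrec.fst) Primrec.snd)))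
  have htrans : Primrec₂ fun (c : NFACode (Fin n)) (S : List ℕ) =>
      ((List.finRange n).map fun a =>
        (Encodable.encode S, some a, 0, Encodable.encode (NFACode.move c S a), [0]) :
        List (ℕ × Option (Fin n) × ℕ × ℕ × List ℕ)) :=
    Primrec.list_map (Primrec.const (List.finRange n)) hentry
  refine Primrec.pair (Primrec.list_flatMap hsub htrans) (Primrec.pair
    (Primrec.encode.comp NFACode.primrec_startSet) (Primrec.pair (Primrec.const 0)
      (Primrec.list_map ?_ (Primrec.encode.comp Primrec.snd))))
  refine ((PrimrecRel.listFilter hacc).comp hsub Primrec.id).of_eq fun x => ?_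
  rfl

/-- The code of a description, in a given class, of the language of a finite automaton. -/
def NFACode.toLangCode : LangClass → NFACode (Fin n) → LangCode (Fin n)
  | .reg, c => .inl c
  | .vpl, c => .inr (.inl (c.1.map (fun t => (t.1, t.2.1, t.2.2, 0)), c.1,
      c.1.map (fun t => (t.1, t.2.1, some 0, t.2.2)) ++ c.1.map (fun t => (t.1, t.2.1, none, t.2.2)),
      c.2.1, c.2.2))
  | .cf, c => .inr (.inr (NFACode.subsetConstruction c))

theorem NFACode.primrec_toLangCode (cls : LangClass) :
    Primrec (NFACode.toLangCode cls : NFACode (Fin n) → LangCode (Fin n)) := by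
  have fst' : Primrec fun y : NFACode (Fin n) × ℕ × Fin n × ℕ => y.2.1 :=
    Primrec.fst.comp Primrec.snd
  have mid : Primrec fun y : NFACode (Fin n) × ℕ × Fin n × ℕ => y.2.2.1 :=
    Primrec.fst.comp (Primrec.snd.comp Primrec.snd)
  have snd' : Primrec fun y : NFACode (Fin n) × ℕ × Fin n × ℕ => y.2.2.2 :=
    Primrec.snd.comp (Primrec.snd.comp Primrec.snd)
  cases cls with
  | reg => exact Primrec.sumInl
  | vpl =>
    refine Primrec.sumInr.comp (Primrec.sumInl.comp (Primrec.pair ?_ (Primrec.pair Primrec.fst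
      (Primrec.pair ?_ Primrec.snd))))
    · exact Primrec.list_map Primrec.fst
        (fst'.pair (mid.pair (snd'.pair (Primrec.const 0))))
    · exact Primrec.list_append.comp
        (Primrec.list_map Primrec.fst (fst'.pair (mid.pair ((Primrec.const (some 0)).pair snd'))))
        (Primrec.list_map Primrec.fst (fst'.pair (mid.pair ((Primrec.const none).pair snd'))))
  | cf => exact Primrec.sumInr.comp (Primrec.sumInr.comp NFACode.primrec_subsetConstruction)

/-- A description, in a given class, of the language of a finite automaton. -/
def NFATable.toLangDesc (M : NFATable (Fin n)) : LangClass → LangDesc (Fin n)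
  | .reg => .nfa M
  | .vpl => .vpa M.toVPA
  | .cf => .dpda M.toDPDA

@[simp] theorem NFATable.cls_toLangDesc (M : NFATable (Fin n)) (cls : LangClass) :
    (M.toLangDesc cls).cls = cls := by
  cases cls <;> rfl

theorem NFATable.code_toLangDesc (M : NFATable (Fin n)) (cls : LangClass) :
    (M.toLangDesc cls).code = NFACode.toLangCode cls M.code := by
  cases cls <;> rfl

@[simp] theorem NFATable.lang_toLangDesc (kind : Fin n → LetterKind) (M : NFATable (Fin n))
    (cls : LangClass) : (M.toLangDesc cls).lang kind = M.lang := by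
  cases cls with
  | reg => rfl
  | vpl => exact M.toVPA_lang kind
  | cf => exact M.toDPDA_lang

/-- The states of a finite DFA are numbered, and its transition function is written out as a table.
-/
theorem Language.IsRegular.exists_nfaTable {R : Language (Fin n)} (hR : R.IsRegular) :
    ∃ M : NFATable (Fin n), M.lang = R := by
  classical
  obtain ⟨σ, _, M, rfl⟩ := hR
  let e : σ → ℕ := fun s => Fintype.equivFin σ s
  have he : Function.Injective e := Fin.val_injective.comp (Fintype.equivFin σ).injective
  let T : NFATable (Fin n) :=
    { trans := ((Finset.univ : Finset (σ × Fin n)).toList.map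
        fun x => (e x.1, x.2, e (M.step x.1 x.2)))
      start := [e M.start]
      accept := ((Finset.univ.filter (· ∈ M.accept)).toList.map e) }
  have hT : ∀ s a p, (e s, a, p) ∈ T.trans ↔ p = e (M.step s a) := by
    intro s a p
    simp only [T, List.mem_map, Finset.mem_toList, Finset.mem_univ, true_and, Prod.mk.injEq,
      Prod.exists]
    constructor
    · rintro ⟨s', a', h1, rfl, rfl⟩
      rw [he h1]
    · rintro rfl
      exact ⟨s, a, rfl, rfl, rfl⟩
  -- The table comes from a deterministic automaton, so a run from a singleton stays a singleton.
  have hrun : ∀ (w : List (Fin n)) (s : σ),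
      T.toNFA.evalFrom {e s} w = {e (M.evalFrom s w)} := by
    intro w
    induction w with
    | nil => simp
    | cons a w ih =>
      intro s
      rw [NFA.evalFrom_cons, DFA.evalFrom_cons, NFA.stepSet_singleton, ← ih]
      congr 1
      ext p
      exact hT s a p
  refine ⟨T, ?_⟩
  ext w
  have hstart : T.toNFA.start = {e M.start} := by
    ext q
    simp [T, NFATable.toNFA]
  change w ∈ T.toNFA.accepts ↔ _
  rw [NFA.mem_accepts, hstart, hrun, DFA.mem_accepts]
  simp only [Set.mem_singleton_iff, exists_eq_right]
  change e (M.evalFrom M.start w) ∈ T.accept ↔ M.evalFrom M.start w ∈ M.accept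
  simp [T, he.eq_iff]

end

/-! ### Renaming of variables -/

section Rename
variable {α : Type}

def StrTerm.rename (ρ : ℕ → ℕ) (s : StrTerm α) : StrTerm α := s.map (Sum.map ρ id)

def LenTerm.rename (ρ : ℕ → ℕ) (l : LenTerm α) : LenTerm α :=
  (l.1, l.2.map fun t => (t.1, Sum.map ρ id t.2))

def Atom.rename (ρ : ℕ → ℕ) : Atom α → Atom α
  | .mem s L => .mem (StrTerm.rename ρ s) L
  | .len l₁ l₂ => .len (LenTerm.rename ρ l₁) (LenTerm.rename ρ l₂)
  | .eqn s₁ s₂ => .eqn (StrTerm.rename ρ s₁) (StrTerm.rename ρ s₂)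

def StrFormula.rename (ρ : ℕ → ℕ) : StrFormula α → StrFormula α
  | .atom A => .atom (A.rename ρ)
  | .neg f => .neg (f.rename ρ)
  | .and f g => .and (f.rename ρ) (g.rename ρ)
  | .or f g => .or (f.rename ρ) (g.rename ρ)
  | .imp f g => .imp (f.rename ρ) (g.rename ρ)
  | .iff f g => .iff (f.rename ρ) (g.rename ρ)

theorem StrTerm.eval_rename (ρ : ℕ → ℕ) (h : ℕ → List α) (s : StrTerm α) :
    StrTerm.eval h (StrTerm.rename ρ s) = StrTerm.eval (h ∘ ρ) s := by
  simp only [StrTerm.eval, StrTerm.rename, List.flatMap_map]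
  congr 1
  ext1 x
  cases x <;> rfl

theorem LenTerm.eval_rename (ρ : ℕ → ℕ) (h : ℕ → List α) (l : LenTerm α) :
    LenTerm.eval h (LenTerm.rename ρ l) = LenTerm.eval (h ∘ ρ) l := by
  simp only [LenTerm.eval, LenTerm.rename, List.map_map]
  congr 3
  ext ⟨k, x⟩
  cases x <;> rfl

theorem Atom.holds_rename (kind : α → LetterKind) (ρ : ℕ → ℕ) (h : ℕ → List α) (A : Atom α) :
    (A.rename ρ).Holds kind h ↔ A.Holds kind (h ∘ ρ) := by
  cases A <;> simp only [Atom.rename, Atom.Holds, StrTerm.eval_rename, LenTerm.eval_rename]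

theorem StrFormula.holds_rename (kind : α → LetterKind) (ρ : ℕ → ℕ) (h : ℕ → List α)
    (f : StrFormula α) : (f.rename ρ).Holds kind h ↔ f.Holds kind (h ∘ ρ) := by
  induction f with
  | atom A => exact A.holds_rename kind ρ h
  | neg f ih => simp only [StrFormula.rename, StrFormula.Holds, ih]
  | and f g ihf ihg | or f g ihf ihg | imp f g ihf ihg | iff f g ihf ihg =>
    simp only [StrFormula.rename, StrFormula.Holds, ihf, ihg]

theorem StrTerm.mem_rename {ρ : ℕ → ℕ} {s : StrTerm α} {x : ℕ} (h : Sum.inl x ∈ s) :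
    Sum.inl (ρ x) ∈ StrTerm.rename ρ s :=
  List.mem_map.2 ⟨_, h, rfl⟩

theorem Atom.Occurs.rename {ρ : ℕ → ℕ} {A : Atom α} {x : ℕ} (h : A.Occurs x) :
    (A.rename ρ).Occurs (ρ x) := by
  cases A with
  | mem s L => exact StrTerm.mem_rename h
  | len l₁ l₂ =>
    obtain ⟨k, h⟩ := h
    exact ⟨k, h.imp (fun h => List.mem_map.2 ⟨_, h, rfl⟩) fun h => List.mem_map.2 ⟨_, h, rfl⟩⟩
  | eqn s₁ s₂ => exact h.imp StrTerm.mem_rename StrTerm.mem_rename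

theorem StrFormula.Occurs.rename {ρ : ℕ → ℕ} {f : StrFormula α} {x : ℕ} (h : f.Occurs x) :
    (f.rename ρ).Occurs (ρ x) := by
  induction f with
  | atom A => exact Atom.Occurs.rename h
  | neg f ih => exact ih h
  | and f g ihf ihg | or f g ihf ihg | imp f g ihf ihg | iff f g ihf ihg => exact h.imp ihf ihg

theorem StrTerm.IsBasic.rename {ρ : ℕ → ℕ} {s : StrTerm α} (h : StrTerm.IsBasic s) :
    StrTerm.IsBasic (StrTerm.rename ρ s) := by
  obtain ⟨x, rfl⟩ | ⟨w, rfl⟩ := h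
  · exact Or.inl ⟨ρ x, rfl⟩
  · exact Or.inr ⟨w, by simp [StrTerm.rename]⟩

theorem TheoryFamily.Allows.rename {F : TheoryFamily} {ρ : ℕ → ℕ} {A : Atom α}
    (h : F.Allows A) : F.Allows (A.rename ρ) := by
  cases A with
  | mem s L => exact ⟨h.1, fun hb => (h.2 hb).rename⟩
  | len l₁ l₂ => exact h
  | eqn s₁ s₂ => exact h

theorem StrFormula.rename_mem_theory {F : TheoryFamily} {ρ : ℕ → ℕ} {f : StrFormula α}
    (h : f ∈ F.theory α) : f.rename ρ ∈ F.theory α := by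
  induction f with
  | atom A => exact TheoryFamily.Allows.rename h
  | neg f ih => exact ih h
  | and f g ihf ihg | or f g ihf ihg | imp f g ihf ihg | iff f g ihf ihg =>
    exact ⟨ihf h.1, ihg h.2⟩

end Rename

/-- Both sides are cut at the first occurrence of `a`, and the word determines its position. -/
theorem List.append_cons_eq_append_cons_iff_of_notMem {α : Type*} {a : α} {x y x' y' : List α}
    (hx : a ∉ x) (hx' : a ∉ x') : x ++ a :: y = x' ++ a :: y' ↔ x = x' ∧ y = y' := by
  constructor
  · intro h
    obtain ⟨z, h1, h2⟩ | ⟨z, h1, h2⟩ := List.append_eq_append_iff.1 h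
    · cases z <;> simp_all
    · cases z <;> simp_all
  · rintro ⟨rfl, rfl⟩
    rfl

/-! ### Universally definable predicates -/

/-- The valuation that is `w` at `0` and `h i` at `i + 1`. -/
def vcons {β : Type*} (w : β) (h : ℕ → β) : ℕ → β
  | 0 => w
  | i + 1 => h i

@[simp] theorem vcons_zero {β : Type*} (w : β) (h : ℕ → β) : vcons w h 0 = w := rfl
@[simp] theorem vcons_succ {β : Type*} (w : β) (h : ℕ → β) (i : ℕ) :
    vcons w h (i + 1) = h i := rfl
@[simp] theorem vcons_one {β : Type*} (w : β) (h : ℕ → β) : vcons w h 1 = h 0 := rfl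

theorem comp_vcons {β : Type*} (h : ℕ → β) (i : ℕ) (σ : ℕ → ℕ) :
    h ∘ vcons i σ = vcons (h i) (h ∘ σ) := by
  funext j
  cases j <;> rfl

/-- Merges two valuations into one. -/
def vmerge {β : Type*} (h b : ℕ → β) : ℕ → β :=
  Sum.elim h b ∘ Equiv.natSumNatEquivNat.symm

/-- A map of variables of merged valuations. -/
def mergeRename (r : ℕ ⊕ ℕ → ℕ ⊕ ℕ) : ℕ → ℕ :=
  Equiv.natSumNatEquivNat ∘ r ∘ Equiv.natSumNatEquivNat.symm

theorem vmerge_comp_mergeRename {β : Type*} (h b h' b' : ℕ → β) (r : ℕ ⊕ ℕ → ℕ ⊕ ℕ)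
    (hr : Sum.elim h b ∘ r = Sum.elim h' b') :
    vmerge h b ∘ mergeRename r = vmerge h' b' := by
  funext i
  simp only [vmerge, mergeRename, Function.comp_apply, Equiv.symm_apply_apply, ← hr]

theorem vmerge_inl {β : Type*} (h b : ℕ → β) (i : ℕ) :
    vmerge h b (Equiv.natSumNatEquivNat (Sum.inl i)) = h i := by
  simp [vmerge]

/-- The predicate `P` of valuations is defined by a formula of the theory with universally
quantified auxiliary variables. -/
def UDef (F : TheoryFamily) {n : ℕ} (kind : Fin n → LetterKind)
    (P : (ℕ → List (Fin n)) → Prop) : Prop :=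
  ∃ f ∈ F.theory (Fin n), ∀ h, P h ↔ ∀ b, f.Holds kind (vmerge h b)

/-- The automaton accepting all words over the given set of letters. -/
def NFATable.lettersIn {α : Type} (l : List α) : NFATable α where
  trans := l.map fun a => (0, a, 0)
  start := [0]
  accept := [0]

theorem NFATable.mem_lang_lettersIn {α : Type} (l w : List α) :
    w ∈ (NFATable.lettersIn l).lang ↔ ∀ a ∈ w, a ∈ l := by
  change w ∈ (NFATable.lettersIn l).toNFA.acceptsFrom {q | q ∈ [0]} ↔ _
  have h0 : {q : ℕ | q ∈ [0]} = {0} := by ext; simp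
  rw [h0]
  induction w with
  | nil => simp [NFATable.toNFA, NFATable.lettersIn]
  | cons a w ih =>
    have hstep : (NFATable.lettersIn l).toNFA.step 0 a = {q | q = 0 ∧ a ∈ l} := by
      ext q
      simp [NFATable.toNFA, NFATable.lettersIn, eq_comm, and_comm]
    rw [NFA.cons_mem_acceptsFrom, NFA.stepSet_singleton, hstep]
    by_cases ha : a ∈ l
    · have : {q | q = 0 ∧ a ∈ l} = {0} := by ext; simp [ha]
      rw [this]
      simpa [ha] using ih
    · have : {q | q = 0 ∧ a ∈ l} = ∅ := by ext; simp [ha]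
      rw [this]
      simp [ha, NFA.mem_acceptsFrom, NFA.evalFrom, List.foldl_fixed']

/-! ### Closure properties of universally definable predicates -/

namespace UDef
variable {F : TheoryFamily} {n : ℕ} {kind : Fin n → LetterKind}
  {P Q : (ℕ → List (Fin n)) → Prop}

theorem congr (hP : UDef F kind P) (h : ∀ v, Q v ↔ P v) : UDef F kind Q := by
  rwa [show Q = P from funext fun v => propext (h v)]

/-- Universal prefixes may be pulled out of a connective if the two sides use disjoint auxiliary
variables. The renamings send those of `f` to one half of the auxiliary variables and those of `g`
to the other. -/
theorem of_binary {C : Prop → Prop → Prop} {c : StrFormula (Fin n) → StrFormula (Fin n) →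
    StrFormula (Fin n)} (hc : ∀ f ∈ F.theory (Fin n), ∀ g ∈ F.theory (Fin n),
      c f g ∈ F.theory (Fin n))
    (hC : ∀ f g v, (c f g).Holds kind v ↔ C (f.Holds kind v) (g.Holds kind v))
    (hCall : ∀ (p q : (ℕ → List (Fin n)) → Prop), C (∀ b, p b) (∀ b, q b) ↔
      ∀ b b', C (p b) (q b'))
    (hP : UDef F kind P) (hQ : UDef F kind Q) : UDef F kind fun v => C (P v) (Q v) := by
  obtain ⟨f, hf, hfP⟩ := hP
  obtain ⟨g, hg, hgQ⟩ := hQ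
  let r₁ : ℕ ⊕ ℕ → ℕ ⊕ ℕ := Sum.map id fun i => Equiv.natSumNatEquivNat (Sum.inl i)
  let r₂ : ℕ ⊕ ℕ → ℕ ⊕ ℕ := Sum.map id fun i => Equiv.natSumNatEquivNat (Sum.inr i)
  have h₁ : ∀ h b : ℕ → List (Fin n), vmerge h b ∘ mergeRename r₁ =
      vmerge h fun i => b (Equiv.natSumNatEquivNat (Sum.inl i)) := fun h b =>
    vmerge_comp_mergeRename _ _ _ _ _ (by ext1 x; cases x <;> rfl)
  have h₂ : ∀ h b : ℕ → List (Fin n), vmerge h b ∘ mergeRename r₂ =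
      vmerge h fun i => b (Equiv.natSumNatEquivNat (Sum.inr i)) := fun h b =>
    vmerge_comp_mergeRename _ _ _ _ _ (by ext1 x; cases x <;> rfl)
  refine ⟨c (f.rename (mergeRename r₁)) (g.rename (mergeRename r₂)),
    hc _ (StrFormula.rename_mem_theory hf) _ (StrFormula.rename_mem_theory hg), fun h => ?_⟩
  simp only [hC, StrFormula.holds_rename, h₁, h₂, hfP, hgQ, hCall]
  constructor
  · intro H b
    exact H _ _
  · intro H b b'
    have := H (vmerge b b')
    simpa [vmerge] using this

theorem and (hP : UDef F kind P) (hQ : UDef F kind Q) : UDef F kind fun v => P v ∧ Q v :=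
  of_binary (c := .and) (fun _ hf _ hg => ⟨hf, hg⟩) (fun _ _ _ => Iff.rfl)
    (fun _ _ => ⟨fun h b b' => ⟨h.1 b, h.2 b'⟩, fun h => ⟨fun b => (h b b).1, fun b => (h b b).2⟩⟩)
    hP hQ

theorem or (hP : UDef F kind P) (hQ : UDef F kind Q) : UDef F kind fun v => P v ∨ Q v :=
  of_binary (c := .or) (fun _ hf _ hg => ⟨hf, hg⟩) (fun _ _ _ => Iff.rfl)
    (fun p q => by simp only [forall_or_left, forall_or_right]) hP hQ

theorem comp_rename (σ : ℕ → ℕ) (hP : UDef F kind P) : UDef F kind fun v => P (v ∘ σ) := by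
  obtain ⟨f, hf, hfP⟩ := hP
  refine ⟨f.rename (mergeRename (Sum.map σ id)), StrFormula.rename_mem_theory hf, fun h => ?_⟩
  have : ∀ b, vmerge h b ∘ mergeRename (Sum.map σ id) = vmerge (h ∘ σ) b := fun b =>
    vmerge_comp_mergeRename _ _ _ _ _ (by ext1 x; cases x <;> rfl)
  simp only [StrFormula.holds_rename, this, hfP]

/-- The quantified word becomes auxiliary variable 0, and the old auxiliary variables move up by
one. -/
theorem all (hP : UDef F kind P) : UDef F kind fun v => ∀ w, P (vcons w v) := by
  obtain ⟨f, hf, hfP⟩ := hP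
  let r : ℕ ⊕ ℕ → ℕ ⊕ ℕ := Sum.elim (vcons (Sum.inr 0) Sum.inl) fun i => Sum.inr (i + 1)
  refine ⟨f.rename (mergeRename r), StrFormula.rename_mem_theory hf, fun h => ?_⟩
  have : ∀ b, vmerge h b ∘ mergeRename r = vmerge (vcons (b 0) h) fun i => b (i + 1) := fun b =>
    vmerge_comp_mergeRename _ _ _ _ _ (by
      ext1 x
      rcases x with (_ | i) | i <;> rfl)
  simp only [StrFormula.holds_rename, this, hfP]
  constructor
  · intro H b
    exact H _ _
  · intro H w b
    exact H (vcons w b)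

theorem of_atom (A : Atom (Fin n)) (hA : F.Allows A) : UDef F kind fun v => A.Holds kind v := by
  refine ⟨.atom (A.rename fun i => Equiv.natSumNatEquivNat (Sum.inl i)),
    TheoryFamily.Allows.rename hA, fun h => ?_⟩
  have : ∀ b, (vmerge h b ∘ fun i => Equiv.natSumNatEquivNat (Sum.inl i)) = h :=
    fun b => funext fun i => vmerge_inl h b i
  simp only [StrFormula.Holds, Atom.holds_rename, this, forall_const]

/-- Negation would turn the universal prefix into an existential one, so it is provided for atoms,
which need no auxiliary variables. -/
theorem of_not_atom (A : Atom (Fin n)) (hA : F.Allows A) :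
    UDef F kind fun v => ¬ A.Holds kind v := by
  refine ⟨.neg (.atom (A.rename fun i => Equiv.natSumNatEquivNat (Sum.inl i))),
    TheoryFamily.Allows.rename (F := F) hA, fun h => ?_⟩
  have : ∀ b, (vmerge h b ∘ fun i => Equiv.natSumNatEquivNat (Sum.inl i)) = h :=
    fun b => funext fun i => vmerge_inl h b i
  simp only [StrFormula.Holds, Atom.holds_rename, this, forall_const]

theorem eq (hstr : F.str = .we) (s t : StrTerm (Fin n)) :
    UDef F kind fun v => StrTerm.eval v s = StrTerm.eval v t :=
  of_atom (.eqn s t) hstr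

theorem ne (hstr : F.str = .we) (s t : StrTerm (Fin n)) :
    UDef F kind fun v => StrTerm.eval v s ≠ StrTerm.eval v t :=
  of_not_atom (.eqn s t) hstr

theorem lettersIn {cls : LangClass} (hstr : F.str = .we) (hcls : F.member = some cls)
    (l : List (Fin n)) (i : ℕ) : UDef F kind fun v => ∀ a ∈ v i, a ∈ l := by
  refine (of_atom (.mem [Sum.inl i] ((NFATable.lettersIn l).toLangDesc cls))
    ⟨by simpa using hcls, by simp [hstr]⟩).congr fun v => ?_
  simp [Atom.Holds, StrTerm.eval, NFATable.mem_lang_lettersIn]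

theorem letter_mem {cls : LangClass} (hstr : F.str = .we) (hcls : F.member = some cls)
    (a : Fin n) (i : ℕ) : UDef F kind fun v => a ∈ v i := by
  refine (of_not_atom (.mem [Sum.inl i] ((NFATable.lettersIn
    ((List.finRange n).filter (· ≠ a))).toLangDesc cls))
    ⟨by simpa using hcls, by simp [hstr]⟩).congr fun v => ?_
  simp [Atom.Holds, StrTerm.eval, NFATable.mem_lang_lettersIn]

/-- The first occurrence of a letter splits a word in a unique way. -/
theorem split {cls : LangClass} (hstr : F.str = .we) (hcls : F.member = some cls)
    (a : Fin n) (i : ℕ) (hP : UDef F kind P) :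
    UDef F kind fun v => ∃ x y, v i = x ++ a :: y ∧ a ∉ x ∧ P (vcons x (vcons y v)) := by
  -- The letter occurs, and every splitting at a first occurrence satisfies `P`; uniqueness makes
  -- this an existence statement. The outer quantifier is `y`, so variable 0 is `x`, variable 1 is
  -- `y`, and the old variables are shifted by 2.
  refine ((letter_mem hstr hcls a i).and (all (all ((ne hstr [Sum.inl (i + 2)]
    [Sum.inl 0, Sum.inr a, Sum.inl 1]).or ((letter_mem hstr hcls a 0).or hP))))).congr fun v => ?_
  simp only [StrTerm.eval, List.flatMap_cons, List.flatMap_nil, Sum.elim_inl, Sum.elim_inr,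
    vcons_zero, vcons_succ, List.append_nil, List.singleton_append]
  constructor
  · rintro ⟨x, y, hv, hx, h⟩
    refine ⟨by simp [hv], fun y' x' => ?_⟩
    by_contra! hc
    obtain ⟨h1, h2, h3⟩ := hc
    rw [h1] at hv
    obtain ⟨rfl, rfl⟩ := (List.append_cons_eq_append_cons_iff_of_notMem hx h2).1 hv.symm
    exact h3 h
  · rintro ⟨h1, h2⟩
    obtain ⟨x, y, hv, hx⟩ := List.eq_append_cons_of_mem h1
    rcases h2 y x with h | h | h
    · exact absurd hv h
    · exact absurd h hx
    · exact ⟨x, y, hv, hx, h⟩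

end UDef

/-! ### Checkable predicates -/

/-- The word consists of letters `ℓ i` with `i < d`. -/
def Over {α : Type} (ℓ : ℕ → α) (d : ℕ) (w : List α) : Prop := ∀ a ∈ w, ∃ i < d, a = ℓ i

namespace Over
variable {α : Type} {ℓ : ℕ → α} {d : ℕ}

theorem mono {d' : ℕ} {w : List α} (h : Over ℓ d w) (hd : d ≤ d') : Over ℓ d' w := fun a ha =>
  let ⟨i, hi, e⟩ := h a ha
  ⟨i, hi.trans_le hd, e⟩

theorem nil : Over ℓ d [] := by simp [Over]

theorem append {v w : List α} (hv : Over ℓ d v) (hw : Over ℓ d w) : Over ℓ d (v ++ w) :=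
  fun a ha => (List.mem_append.1 ha).elim (hv a) (hw a)

theorem cons {w : List α} {i : ℕ} (hi : i < d) (hw : Over ℓ d w) : Over ℓ d (ℓ i :: w) := by
  intro a ha
  rcases List.mem_cons.1 ha with rfl | ha
  · exact ⟨i, hi, rfl⟩
  · exact hw a ha

/-- Letters from index `d` on are fresh for words over the first `d` letters; this is what makes
them usable as separators. -/
theorem notMem {w : List α} (hw : Over ℓ d w) {m i : ℕ} (hℓ : Set.InjOn ℓ (Set.Iio m))
    (hd : d ≤ i) (hi : i < m) : ℓ i ∉ w := by
  intro h
  obtain ⟨j, hj, e⟩ := hw _ h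
  have := hℓ (show i ∈ Set.Iio m from hi) (show j ∈ Set.Iio m from (hj.trans_le hd).trans hi) e
  omega

end Over

theorem UDef.over {F : TheoryFamily} {n : ℕ} {kind : Fin n → LetterKind} {cls : LangClass}
    (hstr : F.str = .we) (hcls : F.member = some cls) (ℓ : ℕ → Fin n) (d i : ℕ) :
    UDef F kind fun v => Over ℓ d (v i) :=
  (UDef.lettersIn hstr hcls ((List.range d).map ℓ) i).congr fun v => by
    simp [Over, eq_comm]

/-- The predicate `P` can be certified: it holds for a valuation if and only if there is a word, the
certificate, for which a universally definable predicate holds; the letters of the certificate can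
be taken from `ℓ 0, …, ℓ (d - 1)`. -/
def Checkable (F : TheoryFamily) {n : ℕ} (kind : Fin n → LetterKind) (ℓ : ℕ → Fin n) (d : ℕ)
    (P : (ℕ → List (Fin n)) → Prop) : Prop :=
  ∃ G, UDef F kind G ∧ (∀ v, P v → ∃ t, Over ℓ d t ∧ G (vcons t v)) ∧
    ∀ v t, G (vcons t v) → P v

/-! ### Closure properties of checkable predicates -/

namespace Checkable
variable {F : TheoryFamily} {n : ℕ} {kind : Fin n → LetterKind} {ℓ : ℕ → Fin n} {d : ℕ}
  {P Q : (ℕ → List (Fin n)) → Prop}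

theorem congr (hP : Checkable F kind ℓ d P) (h : ∀ v, Q v ↔ P v) : Checkable F kind ℓ d Q := by
  rwa [show Q = P from funext fun v => propext (h v)]

theorem mono {d' : ℕ} (hP : Checkable F kind ℓ d P) (hd : d ≤ d') : Checkable F kind ℓ d' P := by
  obtain ⟨G, hG, h1, h2⟩ := hP
  refine ⟨G, hG, fun v hv => ?_, h2⟩
  obtain ⟨t, ht, h⟩ := h1 v hv
  exact ⟨t, ht.mono hd, h⟩

theorem of_uDef (hP : UDef F kind P) : Checkable F kind ℓ d P :=
  ⟨fun v => P (v ∘ Nat.succ), hP.comp_rename _, fun _ hv => ⟨[], Over.nil, hv⟩, fun _ _ h => h⟩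

/-- The certificate need not record which side it proves, because either checker is sound on every
word. No new letter is needed. -/
theorem or (hP : Checkable F kind ℓ d P) (hQ : Checkable F kind ℓ d Q) :
    Checkable F kind ℓ d fun v => P v ∨ Q v := by
  obtain ⟨G, hG, h1, h2⟩ := hP
  obtain ⟨G', hG', h1', h2'⟩ := hQ
  refine ⟨fun v => G v ∨ G' v, hG.or hG', ?_, fun v t => Or.imp (h2 v t) (h2' v t)⟩
  rintro v (hv | hv)
  · obtain ⟨t, ht, h⟩ := h1 v hv
    exact ⟨t, ht, Or.inl h⟩
  · obtain ⟨t, ht, h⟩ := h1' v hv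
    exact ⟨t, ht, Or.inr h⟩

theorem comp_rename (σ : ℕ → ℕ) (hP : Checkable F kind ℓ d P) :
    Checkable F kind ℓ d fun v => P (v ∘ σ) := by
  obtain ⟨G, hG, h1, h2⟩ := hP
  have h : ∀ t (v : ℕ → List (Fin n)), vcons t v ∘ vcons 0 (fun i => σ i + 1) = vcons t (v ∘ σ) :=
    fun t v => comp_vcons _ _ _
  refine ⟨_, hG.comp_rename (vcons 0 fun i => σ i + 1), fun v hv => ?_, fun v t hv => ?_⟩
  · obtain ⟨t, ht, hG⟩ := h1 _ hv
    exact ⟨t, ht, by rwa [h]⟩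
  · rw [h] at hv
    exact h2 _ _ hv

/-- A checkable relation between two words, applied to other variables. -/
theorem rel {R : List (Fin n) → List (Fin n) → Prop}
    (hR : Checkable F kind ℓ d fun v => R (v 0) (v 1)) (i j : ℕ) :
    Checkable F kind ℓ d fun v => R (v i) (v j) :=
  hR.comp_rename (vcons i fun _ => j)

/-- The two certificates are joined by the fresh letter `ℓ d`; splitting at its first occurrence
recovers them. -/
theorem and {cls : LangClass} (hstr : F.str = .we) (hcls : F.member = some cls)
    (hℓ : Set.InjOn ℓ (Set.Iio (d + 1))) (hP : Checkable F kind ℓ d P)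
    (hQ : Checkable F kind ℓ d Q) : Checkable F kind ℓ (d + 1) fun v => P v ∧ Q v := by
  obtain ⟨G, hG, h1, h2⟩ := hP
  obtain ⟨G', hG', h1', h2'⟩ := hQ
  have e1 : ∀ x y t (v : ℕ → List (Fin n)), vcons x (vcons y (vcons t v)) ∘
      vcons 0 (fun i => i + 3) = vcons x v := fun x y t v => comp_vcons _ _ _
  have e2 : ∀ x y t (v : ℕ → List (Fin n)), vcons x (vcons y (vcons t v)) ∘
      vcons 1 (fun i => i + 3) = vcons y v := fun x y t v => comp_vcons _ _ _
  refine ⟨_, UDef.split hstr hcls (ℓ d) 0 ((hG.comp_rename (vcons 0 fun i => i + 3)).and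
    (hG'.comp_rename (vcons 1 fun i => i + 3))), fun v hv => ?_, fun v t h => ?_⟩
  · obtain ⟨x, hx, hGx⟩ := h1 v hv.1
    obtain ⟨y, hy, hGy⟩ := h1' v hv.2
    refine ⟨x ++ ℓ d :: y, (hx.mono (by omega)).append (Over.cons (by omega) (hy.mono (by omega))),
      x, y, rfl, hx.notMem hℓ le_rfl (by omega), ?_, ?_⟩
    · rwa [e1]
    · rwa [e2]
  · obtain ⟨x, y, -, -, h, h'⟩ := h
    rw [e1] at h
    rw [e2] at h'
    exact ⟨h2 _ _ h, h2' _ _ h'⟩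

/-- The certificate is the witness `u`, the fresh letter `ℓ d`, and a certificate for `u`. The
witness must avoid `ℓ d`, which is what `hover` ensures. -/
theorem ex {cls : LangClass} (hstr : F.str = .we) (hcls : F.member = some cls)
    (hℓ : Set.InjOn ℓ (Set.Iio (d + 1))) (hP : Checkable F kind ℓ d P)
    (hover : ∀ u v, P (vcons u v) → Over ℓ d u) :
    Checkable F kind ℓ (d + 1) fun v => ∃ u, P (vcons u v) := by
  obtain ⟨G, hG, h1, h2⟩ := hP
  have e1 : ∀ u y t (v : ℕ → List (Fin n)), vcons u (vcons y (vcons t v)) ∘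
      vcons 1 (vcons 0 fun i => i + 3) = vcons y (vcons u v) := fun u y t v => by
    rw [comp_vcons, comp_vcons]
    rfl
  refine ⟨_, UDef.split hstr hcls (ℓ d) 0 (hG.comp_rename (vcons 1 (vcons 0 fun i => i + 3))),
    fun v hv => ?_, fun v t h => ?_⟩
  · obtain ⟨u, hu⟩ := hv
    obtain ⟨y, hy, hGy⟩ := h1 _ hu
    have hou := hover u v hu
    refine ⟨u ++ ℓ d :: y, (hou.mono (by omega)).append (Over.cons (by omega)
      (hy.mono (by omega))), u, y, rfl, hou.notMem hℓ le_rfl (by omega), ?_⟩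
    rwa [e1]
  · obtain ⟨u, y, -, -, h⟩ := h
    rw [e1] at h
    exact ⟨u, h2 _ _ h⟩

/-- Certificates of the steps of a chain, put into a row, certify the chain. -/
theorem reflTransGen {cls : LangClass} (hstr : F.str = .we) (hcls : F.member = some cls)
    (hℓ : Set.InjOn ℓ (Set.Iio (d + 2))) {R : List (Fin n) → List (Fin n) → Prop}
    (hR : Checkable F kind ℓ d fun v => R (v 0) (v 1))
    (hover : ∀ x y, R x y → Over ℓ d x ∧ Over ℓ d y) :
    Checkable F kind ℓ (d + 2) fun v =>
      Over ℓ d (v 0) ∧ Relation.ReflTransGen R (v 0) (v 1) := by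
  obtain ⟨G, hG, h1, h2⟩ := hR
  -- The row for a chain has the form `ℓ d, x₀, ℓ (d+1), t₀, ℓ d, x₁, ℓ (d+1), …, ℓ d, xₖ, ℓ (d+1)`,
  -- where `tᵢ` certifies the step from `xᵢ` to `xᵢ₊₁`. A link inspects what follows one letter `ℓ
  -- d`: either the row ends there with the last word `v 1`, or the next step is certified.
  let link (v : ℕ → List (Fin n)) (s : List (Fin n)) : Prop :=
    ∃ a r, s = a ++ ℓ (d + 1) :: r ∧ ℓ (d + 1) ∉ a ∧ ((r = [] ∧ a = v 1) ∨
      ∃ t r', r = t ++ ℓ d :: r' ∧ ℓ d ∉ t ∧ ∃ b r'', r' = b ++ ℓ (d + 1) :: r'' ∧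
        ℓ (d + 1) ∉ b ∧ G (vcons t (vcons a (vcons b v))))
  have hlink : UDef F kind fun v => link (fun i => v (i + 3)) (v 0) := by
    -- Three nested splittings introduce six variables: `b` is 0, `t` is 2 and `a` is 4. The shift 9
    -- also skips `s`, `p` and the certificate.
    have hG' := (hG.comp_rename (vcons 2 (vcons 4 (vcons 0 fun i => i + 9)))).congr
      (Q := fun v => G (vcons (v 2) (vcons (v 4) (vcons (v 0) fun i => v (i + 9)))))
      fun v => by
        rw [comp_vcons, comp_vcons, comp_vcons]
        rfl
    refine (UDef.split hstr hcls (ℓ (d + 1)) 0 (((UDef.eq hstr [Sum.inl 1] []).and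
      (UDef.eq hstr [Sum.inl 0] [Sum.inl 6])).or (UDef.split hstr hcls (ℓ d) 1
        (UDef.split hstr hcls (ℓ (d + 1)) 1 hG')))).congr fun v => ?_
    simp [link, StrTerm.eval]
  -- The row starts with `ℓ d`, `v 0`, `ℓ (d+1)` (indices are raised by one, since variable 0 is the
  -- certificate), and every occurrence of `ℓ d` starts a link. The condition `Over ℓ d` matters for
  -- the empty chain, where `R` does not restrict the letters of the word.
  refine ⟨fun v => (Over ℓ d (v 1) ∧ ∃ x s, v 0 = x ++ ℓ d :: s ∧ ℓ d ∉ x ∧ (x = [] ∧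
      ∃ a r, s = a ++ ℓ (d + 1) :: r ∧ ℓ (d + 1) ∉ a ∧ a = v 1)) ∧
      ∀ p s, v 0 ≠ p ++ ℓ d :: s ∨ link (fun i => v (i + 1)) s, ?_, ?_, ?_⟩
  · refine ((UDef.over hstr hcls ℓ d 1).and (UDef.split hstr hcls (ℓ d) 0
      ((UDef.eq hstr [Sum.inl 0] []).and (UDef.split hstr hcls (ℓ (d + 1)) 1
        (UDef.eq hstr [Sum.inl 0] [Sum.inl 5]))))).and
      (UDef.all (UDef.all ((UDef.ne hstr [Sum.inl 2] [Sum.inl 1, Sum.inr (ℓ d), Sum.inl 0]).or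
        hlink))) |>.congr fun v => ?_
    simp [StrTerm.eval]
  · rintro v ⟨hv, hR⟩
    have hsep : ℓ d ≠ ℓ (d + 1) := fun h => by
      have := hℓ (show d ∈ Set.Iio (d + 2) by simp) (show d + 1 ∈ Set.Iio (d + 2) by simp) h
      omega
    have key : ∃ s, Over ℓ (d + 2) s ∧ (∃ r, s = v 0 ++ ℓ (d + 1) :: r) ∧
        ∀ p s', ℓ d :: s = p ++ ℓ d :: s' → link v s' := by
      generalize v 0 = x at hv hR
      induction hR using Relation.ReflTransGen.head_induction_on with
      | refl =>
        refine ⟨v 1 ++ [ℓ (d + 1)], (hv.mono (by omega)).append (Over.cons (by omega) Over.nil),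
          ⟨[], rfl⟩, fun p s' h => ?_⟩
        have hd1 : ℓ (d + 1) ∉ v 1 := hv.notMem hℓ (by omega) (by omega)
        have hd : ℓ d ∉ v 1 := hv.notMem hℓ (by omega) (by omega)
        cases p with
        | nil =>
          obtain rfl : v 1 ++ [ℓ (d + 1)] = s' := by simpa using h
          exact ⟨v 1, [], rfl, hd1, Or.inl ⟨rfl, rfl⟩⟩
        | cons c p =>
          have : ℓ d ∈ v 1 ++ [ℓ (d + 1)] := by
            rw [(List.cons.inj h).2]
            simp
          simp [hd, hsep] at this
      | @head x y hxy _ ih =>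
        obtain ⟨hx, hy⟩ := hover x y hxy
        obtain ⟨s, hs, ⟨r, hr⟩, hall⟩ := ih hy
        obtain ⟨t, ht, hGt⟩ := h1 (vcons x (vcons y v)) hxy
        refine ⟨x ++ ℓ (d + 1) :: (t ++ ℓ d :: s), (hx.mono (by omega)).append
          (Over.cons (by omega) ((ht.mono (by omega)).append (Over.cons (by omega) hs))),
          ⟨_, rfl⟩, fun p s' h => ?_⟩
        cases p with
        | nil =>
          obtain rfl : x ++ ℓ (d + 1) :: (t ++ ℓ d :: s) = s' := by simpa using h
          exact ⟨x, _, rfl, hx.notMem hℓ (by omega) (by omega), Or.inr ⟨t, s, rfl,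
            ht.notMem hℓ (by omega) (by omega), y, r, hr, hy.notMem hℓ (by omega) (by omega),
            hGt⟩⟩
        | cons c p =>
          -- The first block contains no further `ℓ d`, so any later occurrence lies in the row of
          -- the remaining chain.
          have hd : ℓ d ∉ x ++ ℓ (d + 1) :: t := by
            simp only [List.mem_append, List.mem_cons, not_or]
            exact ⟨hx.notMem hℓ (by omega) (by omega), hsep,
              ht.notMem hℓ (by omega) (by omega)⟩
          have h' : (x ++ ℓ (d + 1) :: t) ++ ℓ d :: s = p ++ ℓ d :: s' := by
            simpa using (List.cons.inj h).2
          obtain ⟨z, h3, h4⟩ | ⟨z, h3, h4⟩ := List.append_eq_append_iff.1 h'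
          · exact hall z s' h4
          · cases z with
            | nil => exact hall [] s' (by simpa using h4.symm)
            | cons c z =>
              obtain ⟨rfl, -⟩ := List.cons.inj h4
              simp [h3] at hd
    obtain ⟨s, hs, ⟨r, hr⟩, hall⟩ := key
    refine ⟨ℓ d :: s, Over.cons (by omega) hs, ⟨hv, [], s, rfl, by simp, rfl, v 0, r, hr,
      hv.notMem hℓ (by omega) (by omega), rfl⟩, fun p s' => ?_⟩
    by_cases h : ℓ d :: s = p ++ ℓ d :: s'
    · exact Or.inr (hall p s' h)
    · exact Or.inl h
  · rintro v t ⟨⟨hv, x, s, ht, -, rfl, a, r, hs, ha, rfl⟩, hall⟩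
    refine ⟨hv, ?_⟩
    simp only [vcons_zero, vcons_one, List.nil_append] at ht hs ha
    replace hall : ∀ p s', ℓ d :: s = p ++ ℓ d :: s' → link v s' := fun p s' h =>
      (hall p s').resolve_left fun hne => hne (ht.trans h)
    clear ht hv
    change Relation.ReflTransGen R (v 0) (v 1)
    generalize v 0 = a at hs ha
    -- Soundness follows by consuming one block at a time. Occurrences of `ℓ d` in the rest are
    -- occurrences in the whole row with a longer prefix, so the links remain available.
    induction hm : s.length using Nat.strong_induction_on generalizing s a r with
    | _ m ih =>
    obtain ⟨a', r', h3, ha', h4⟩ := hall [] s rfl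
    rw [hs] at h3
    obtain ⟨rfl, rfl⟩ := (List.append_cons_eq_append_cons_iff_of_notMem ha ha').1 h3
    rcases h4 with ⟨-, h4⟩ | ⟨t, r', h4, -, b, r'', h5, hb, hG⟩
    · rw [h4]
    · refine .head (h2 (vcons a (vcons b v)) t hG) (ih r'.length ?_ r' r'' ?_ b h5 hb rfl)
      · subst hm hs h4
        simp
        omega
      · intro p s' h
        refine hall (ℓ d :: (a ++ ℓ (d + 1) :: t) ++ p) s' ?_
        rw [hs, h4, h]
        simp
end Checkable

/-! ### Certificates of computations -/

/-- Lists of natural numbers as words over two letters: each number is written in unary, followed by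
`ℓ 1`. -/
def encodeNats {α : Type} (ℓ : ℕ → α) : List ℕ → List α
  | [] => []
  | m :: l => List.replicate m (ℓ 0) ++ ℓ 1 :: encodeNats ℓ l

section Encode
variable {α : Type} {ℓ : ℕ → α}

theorem over_encodeNats (x : List ℕ) : Over ℓ 2 (encodeNats ℓ x) := by
  induction x with
  | nil => exact Over.nil
  | cons m l ih =>
    refine Over.append (fun a ha => ?_) (Over.cons (by omega) ih)
    exact ⟨0, by omega, List.eq_of_mem_replicate ha⟩

@[simp] theorem encodeNats_eq_nil {x : List ℕ} : encodeNats ℓ x = [] ↔ x = [] := by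
  cases x <;> simp [encodeNats]

theorem encodeNats_eq_append (h01 : ℓ 0 ≠ ℓ 1) {x : List ℕ} {a b : List α} :
    (encodeNats ℓ x = a ++ ℓ 1 :: b ∧ ℓ 1 ∉ a) ↔
      ∃ m l, x = m :: l ∧ a = List.replicate m (ℓ 0) ∧ b = encodeNats ℓ l := by
  have hrep : ∀ m, ℓ 1 ∉ List.replicate m (ℓ 0) := fun m h => h01 (List.eq_of_mem_replicate h).symm
  constructor
  · rintro ⟨h, ha⟩
    cases x with
    | nil => simp [encodeNats] at h
    | cons m l =>
      obtain ⟨rfl, rfl⟩ := (List.append_cons_eq_append_cons_iff_of_notMem (hrep m) ha).1 h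
      exact ⟨m, l, rfl, rfl, rfl⟩
  · rintro ⟨m, l, rfl, rfl, rfl⟩
    exact ⟨rfl, hrep m⟩

/-- The first `ℓ 1` ends the first number. This translates the patterns that `UDef.split` can
express into case distinctions on lists. -/
theorem exists_encodeNats_split (h01 : ℓ 0 ≠ ℓ 1) {x : List ℕ} {Q : List α → List α → Prop} :
    (∃ a b, encodeNats ℓ x = a ++ ℓ 1 :: b ∧ ℓ 1 ∉ a ∧ Q a b) ↔
      ∃ m l, x = m :: l ∧ Q (List.replicate m (ℓ 0)) (encodeNats ℓ l) := by
  constructor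
  · rintro ⟨a, b, h1, h2, h⟩
    obtain ⟨m, l, rfl, rfl, rfl⟩ := (encodeNats_eq_append h01).1 ⟨h1, h2⟩
    exact ⟨m, l, rfl, h⟩
  · rintro ⟨m, l, rfl, h⟩
    obtain ⟨h1, h2⟩ := (encodeNats_eq_append h01).2 ⟨m, l, rfl, rfl, rfl⟩
    exact ⟨_, _, h1, h2, h⟩

theorem encodeNats_injective (h01 : ℓ 0 ≠ ℓ 1) : Function.Injective (encodeNats ℓ) := by
  intro x
  induction x with
  | nil =>
    intro y h
    exact (encodeNats_eq_nil.1 h.symm).symm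
  | cons m l ih =>
    intro y h
    obtain ⟨m', l', rfl, h1, h2⟩ := (encodeNats_eq_append h01).1 ⟨h.symm,
      ((encodeNats_eq_append h01).2 ⟨m, l, rfl, rfl, rfl⟩).2⟩
    have := congrArg List.length h1
    simp only [List.length_replicate] at this
    rw [this, ih h2]

theorem encodeNats_eq_one_cons (h01 : ℓ 0 ≠ ℓ 1) {x : List ℕ} {w : List α} :
    encodeNats ℓ x = ℓ 1 :: w ↔ ∃ l, x = 0 :: l ∧ w = encodeNats ℓ l := by
  constructor
  · intro h
    obtain ⟨m, l, rfl, h1, h2⟩ := (encodeNats_eq_append (a := []) h01).1 ⟨h, by simp⟩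
    have : m = 0 := by simpa using congrArg List.length h1.symm
    exact ⟨l, by rw [this], h2⟩
  · rintro ⟨l, rfl, rfl⟩
    rfl

/-- A word over `ℓ 0`, `ℓ 1` fails to encode a list only if its last unary block is not closed. In
this form the condition is universal. -/
theorem exists_eq_encodeNats_iff (h01 : ℓ 0 ≠ ℓ 1) (v : List α) : (∃ x, v = encodeNats ℓ x) ↔
    Over ℓ 2 v ∧ ∀ p, v ≠ p ++ [ℓ 0] := by
  constructor
  · rintro ⟨x, rfl⟩
    refine ⟨over_encodeNats x, ?_⟩
    induction x with
    | nil => simp [encodeNats]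
    | cons m l ih =>
      intro p h
      simp only [encodeNats] at h
      rcases List.eq_nil_or_concat' (encodeNats ℓ l) with hl | ⟨q, a, hq⟩
      · rw [hl] at h
        exact h01 (List.singleton_inj.1 (List.append_inj' h rfl).2).symm
      · rw [hq, ← List.cons_append, ← List.append_assoc] at h
        rw [List.singleton_inj.1 (List.append_inj' h rfl).2] at hq
        exact ih q hq
  · rintro ⟨hv, hlast⟩
    induction v with
    | nil => exact ⟨[], rfl⟩
    | cons a v ih =>
      obtain ⟨x, rfl⟩ := ih (fun b hb => hv b (by simp [hb])) fun p h =>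
        hlast (a :: p) (by simp [h])
      obtain ⟨i, hi, rfl⟩ := hv a (by simp)
      obtain rfl | rfl : i = 0 ∨ i = 1 := by omega
      · cases x with
        | nil => exact absurd rfl (hlast [])
        | cons m l => exact ⟨(m + 1) :: l, rfl⟩
      · exact ⟨0 :: x, rfl⟩

end Encode

open Turing.ToPartrec in
/-- The graph of the partial function computed by a code, on words. -/
def CodeGraph {α : Type} (ℓ : ℕ → α) (c : Code) (v w : List α) : Prop :=
  ∃ x y, y ∈ c.eval x ∧ v = encodeNats ℓ x ∧ w = encodeNats ℓ y

/-! ### Word descriptions of the graphs of the code constructors -/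

section Graph
open Turing.ToPartrec
variable {α : Type} {ℓ : ℕ → α}

theorem CodeGraph.over {c : Code} {v w : List α} (h : CodeGraph ℓ c v w) :
    Over ℓ 2 v ∧ Over ℓ 2 w := by
  obtain ⟨x, y, -, rfl, rfl⟩ := h
  exact ⟨over_encodeNats x, over_encodeNats y⟩

theorem codeGraph_encodeNats_left (h01 : ℓ 0 ≠ ℓ 1) {c : Code} {x : List ℕ} {w : List α} :
    CodeGraph ℓ c (encodeNats ℓ x) w ↔ ∃ y ∈ c.eval x, w = encodeNats ℓ y := by
  constructor
  · rintro ⟨x', y', h, hx, hy⟩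
    rw [encodeNats_injective h01 hx]
    exact ⟨y', h, hy⟩
  · rintro ⟨y, h, rfl⟩
    exact ⟨x, y, h, rfl, rfl⟩

theorem codeGraph_zero' {v w : List α} : CodeGraph ℓ .zero' v w ↔
    (∃ x, v = encodeNats ℓ x) ∧ w = ℓ 1 :: v := by
  constructor
  · rintro ⟨x, y, h, rfl, rfl⟩
    obtain rfl : y = 0 :: x := by simpa using h
    exact ⟨⟨x, rfl⟩, rfl⟩
  · rintro ⟨⟨x, rfl⟩, rfl⟩
    exact ⟨x, 0 :: x, by simp, rfl, rfl⟩

/-- The empty list is a separate case because `headI` reads its head as 0; the same default returns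
in `cons`, `case` and `fix`. -/
theorem codeGraph_succ (h01 : ℓ 0 ≠ ℓ 1) {v w : List α} : CodeGraph ℓ .succ v w ↔
    (∃ x, v = encodeNats ℓ x) ∧ ((v = [] ∧ w = [ℓ 0, ℓ 1]) ∨
      ∃ a b, v = a ++ ℓ 1 :: b ∧ ℓ 1 ∉ a ∧ w = ℓ 0 :: (a ++ [ℓ 1])) := by
  rw [show CodeGraph ℓ .succ v w ↔ ∃ x, v = encodeNats ℓ x ∧
    w = encodeNats ℓ [x.headI.succ] by simp [CodeGraph], ← exists_and_right]
  refine exists_congr fun x => and_congr_right ?_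
  rintro rfl
  rw [exists_encodeNats_split h01]
  cases x <;> simp [encodeNats, List.replicate_succ]

theorem codeGraph_tail (h01 : ℓ 0 ≠ ℓ 1) {v w : List α} : CodeGraph ℓ .tail v w ↔
    (∃ x, v = encodeNats ℓ x) ∧ ((v = [] ∧ w = []) ∨
      ∃ a b, v = a ++ ℓ 1 :: b ∧ ℓ 1 ∉ a ∧ w = b) := by
  rw [show CodeGraph ℓ .tail v w ↔ ∃ x, v = encodeNats ℓ x ∧
    w = encodeNats ℓ x.tail by simp [CodeGraph], ← exists_and_right]
  refine exists_congr fun x => and_congr_right ?_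
  rintro rfl
  rw [exists_encodeNats_split h01]
  cases x <;> simp [encodeNats]

theorem codeGraph_cons (h01 : ℓ 0 ≠ ℓ 1) {f fs : Code} {v w : List α} : CodeGraph ℓ (.cons f fs) v w ↔
    ∃ u, CodeGraph ℓ f v u ∧ ∃ u', CodeGraph ℓ fs v u' ∧ ((u = [] ∧ w = ℓ 1 :: u') ∨
      ∃ a b, u = a ++ ℓ 1 :: b ∧ ℓ 1 ∉ a ∧ w = a ++ ℓ 1 :: u') := by
  have key : ∀ y z : List ℕ, w = encodeNats ℓ (y.headI :: z) ↔
      ((encodeNats ℓ y = [] ∧ w = ℓ 1 :: encodeNats ℓ z) ∨ ∃ a b, encodeNats ℓ y = a ++ ℓ 1 :: b ∧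
        ℓ 1 ∉ a ∧ w = a ++ ℓ 1 :: encodeNats ℓ z) := by
    intro y z
    rw [exists_encodeNats_split h01]
    cases y <;> simp [encodeNats]
  constructor
  · rintro ⟨x, y, h, rfl, rfl⟩
    obtain ⟨z, hz, z', hz', rfl⟩ : ∃ z ∈ f.eval x, ∃ z' ∈ fs.eval x, y = z.headI :: z' := by
      simpa using h
    exact ⟨_, ⟨x, z, hz, rfl, rfl⟩, _, ⟨x, z', hz', rfl, rfl⟩, (key z z').1 rfl⟩
  · rintro ⟨_, ⟨x, z, hz, rfl, rfl⟩, u', h, hw⟩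
    obtain ⟨z', hz', rfl⟩ := (codeGraph_encodeNats_left h01).1 h
    refine ⟨x, z.headI :: z', ?_, rfl, (key z z').2 hw⟩
    simp only [Code.cons_eval, Part.bind_eq_bind, Part.mem_bind_iff]
    exact ⟨z, hz, z', hz', Part.mem_some _⟩

theorem codeGraph_comp (h01 : ℓ 0 ≠ ℓ 1) {f g : Code} {v w : List α} : CodeGraph ℓ (.comp f g) v w ↔
    ∃ u, CodeGraph ℓ g v u ∧ CodeGraph ℓ f u w := by
  constructor
  · rintro ⟨x, y, h, rfl, rfl⟩
    obtain ⟨z, hz, hy⟩ : ∃ z ∈ g.eval x, y ∈ f.eval z := by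
      rw [Code.comp_eval] at h
      exact Part.mem_bind_iff.1 h
    exact ⟨_, ⟨x, z, hz, rfl, rfl⟩, _, _, hy, rfl, rfl⟩
  · rintro ⟨_, ⟨x, z, hz, rfl, rfl⟩, h⟩
    obtain ⟨y, hy, rfl⟩ := (codeGraph_encodeNats_left h01).1 h
    refine ⟨x, y, ?_, rfl, rfl⟩
    rw [Code.comp_eval]
    exact Part.mem_bind_iff.2 ⟨z, hz, hy⟩

/-- The first letter decides: `ℓ 1` means that the head is 0, and removing a leading `ℓ 0` lowers a
positive head by one. The condition `u ≠ []` excludes the word `[ℓ 0]`, which encodes nothing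
although its tail encodes the empty list. -/
theorem codeGraph_case {f g : Code} {v w : List α} : CodeGraph ℓ (.case f g) v w ↔
    ∃ u, (((v = [] ∧ u = []) ∨ v = ℓ 1 :: u) ∧ CodeGraph ℓ f u w) ∨
      ((v = ℓ 0 :: u ∧ u ≠ []) ∧ CodeGraph ℓ g u w) := by
  constructor
  · rintro ⟨x, y, h, rfl, rfl⟩
    match x, h with
    | [], h => exact ⟨[], Or.inl ⟨Or.inl ⟨rfl, rfl⟩, [], y, by simpa using h, rfl, rfl⟩⟩
    | 0 :: l, h => exact ⟨_, Or.inl ⟨Or.inr rfl, l, y, by simpa using h, rfl, rfl⟩⟩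
    | (m + 1) :: l, h =>
      exact ⟨_, Or.inr ⟨⟨rfl, by simp⟩, m :: l, y, by simpa using h, rfl, rfl⟩⟩
  · rintro ⟨_, ⟨h, x, y, hy, rfl, rfl⟩ | ⟨⟨rfl, h⟩, x, y, hy, rfl, rfl⟩⟩
    · rcases h with ⟨rfl, h⟩ | rfl
      · obtain rfl := encodeNats_eq_nil.1 h
        exact ⟨[], y, by simpa using hy, rfl, rfl⟩
      · exact ⟨0 :: x, y, by simpa using hy, rfl, rfl⟩
    · cases x with
      | nil => exact absurd rfl h
      | cons m l => exact ⟨(m + 1) :: l, y, by simpa using hy, rfl, rfl⟩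

/-- Unfolding the loop gives a finite chain of `Sum.inr` rounds followed by one `Sum.inl` round. -/
theorem PFun.mem_fix_iff_reflTransGen {σ τ : Type*} (f : σ →. τ ⊕ σ) (a : σ) (b : τ) :
    b ∈ f.fix a ↔
      ∃ a', Relation.ReflTransGen (fun x y => Sum.inr y ∈ f x) a a' ∧ Sum.inl b ∈ f a' := by
  constructor
  · intro h
    refine PFun.fixInduction' (C := fun a => ∃ a', Relation.ReflTransGen
      (fun x y => Sum.inr y ∈ f x) a a' ∧ Sum.inl b ∈ f a') h (fun a h => ⟨a, .refl, h⟩) ?_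
    rintro a₀ a₁ - h ⟨a', h', hb⟩
    exact ⟨a', .head h h', hb⟩
  · rintro ⟨a', h, hb⟩
    induction h using Relation.ReflTransGen.head_induction_on with
    | refl => exact PFun.mem_fix_iff.2 (Or.inl hb)
    | head h _ ih => exact PFun.mem_fix_iff.2 (Or.inr ⟨_, h, ih⟩)

/-- One round of the loop `fix f`, on words. -/
def FixStep (ℓ : ℕ → α) (f : Code) (v w : List α) : Prop :=
  ∃ u, CodeGraph ℓ f v u ∧ ∃ a b, u = a ++ ℓ 1 :: b ∧ ℓ 1 ∉ a ∧ (a ≠ [] ∧ w = b)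

/-- The last round of the loop `fix f`, on words. -/
def FixStop (ℓ : ℕ → α) (f : Code) (v w : List α) : Prop :=
  ∃ u, CodeGraph ℓ f v u ∧ ((u = [] ∧ w = []) ∨ u = ℓ 1 :: w)

theorem fixStep_iff (h01 : ℓ 0 ≠ ℓ 1) {f : Code} {v w : List α} : FixStep ℓ f v w ↔
    ∃ x y, (∃ z ∈ f.eval x, z.headI ≠ 0 ∧ z.tail = y) ∧ v = encodeNats ℓ x ∧
      w = encodeNats ℓ y := by
  constructor
  · rintro ⟨_, ⟨x, z, hz, rfl, rfl⟩, h⟩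
    obtain ⟨m, l, rfl, hm, rfl⟩ := (exists_encodeNats_split h01).1 h
    exact ⟨x, l, ⟨_, hz, by simpa using hm, rfl⟩, rfl, rfl⟩
  · rintro ⟨x, _, ⟨z, hz, h0, rfl⟩, rfl, rfl⟩
    refine ⟨_, ⟨x, z, hz, rfl, rfl⟩, (exists_encodeNats_split h01).2 ?_⟩
    cases z with
    | nil => exact absurd rfl h0
    | cons m l => exact ⟨m, l, rfl, by simpa using h0, rfl⟩

theorem fixStop_iff (h01 : ℓ 0 ≠ ℓ 1) {f : Code} {v w : List α} : FixStop ℓ f v w ↔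
    ∃ x y, (∃ z ∈ f.eval x, z.headI = 0 ∧ z.tail = y) ∧ v = encodeNats ℓ x ∧
      w = encodeNats ℓ y := by
  constructor
  · rintro ⟨_, ⟨x, z, hz, rfl, rfl⟩, ⟨h, rfl⟩ | h⟩
    · obtain rfl := encodeNats_eq_nil.1 h
      exact ⟨x, [], ⟨_, hz, rfl, rfl⟩, rfl, rfl⟩
    · obtain ⟨l, rfl, rfl⟩ := (encodeNats_eq_one_cons h01).1 h
      exact ⟨x, l, ⟨_, hz, rfl, rfl⟩, rfl, rfl⟩
  · rintro ⟨x, _, ⟨z, hz, h0, rfl⟩, rfl, rfl⟩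
    refine ⟨_, ⟨x, z, hz, rfl, rfl⟩, ?_⟩
    cases z with
    | nil => exact Or.inl ⟨rfl, rfl⟩
    | cons m l =>
      obtain rfl : m = 0 := h0
      exact Or.inr rfl

/-- A nonzero head of the result of `f` continues the loop with the tail, and a zero head stops it.
The conjunct `Over ℓ 2 v` gives the chain the shape that `Checkable.reflTransGen` certifies. -/
theorem codeGraph_fix (h01 : ℓ 0 ≠ ℓ 1) {f : Code} {v w : List α} : CodeGraph ℓ (.fix f) v w ↔
    ∃ u, (Over ℓ 2 v ∧ Relation.ReflTransGen (FixStep ℓ f) v u) ∧ FixStop ℓ f u w := by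
  let F : List ℕ →. List ℕ ⊕ List ℕ := fun v => (f.eval v).map fun v =>
    if v.headI = 0 then Sum.inl v.tail else Sum.inr v.tail
  have hr : ∀ x y, Sum.inr y ∈ F x ↔ ∃ z ∈ f.eval x, z.headI ≠ 0 ∧ z.tail = y := by
    intro x y
    simp only [F, Part.mem_map_iff]
    refine exists_congr fun z => and_congr_right fun _ => ?_
    by_cases h : z.headI = 0 <;> simp [h]
  have hl : ∀ x y, Sum.inl y ∈ F x ↔ ∃ z ∈ f.eval x, z.headI = 0 ∧ z.tail = y := by
    intro x y
    simp only [F, Part.mem_map_iff]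
    refine exists_congr fun z => and_congr_right fun _ => ?_
    by_cases h : z.headI = 0 <;> simp [h]
  have hfix : ∀ x y, y ∈ (Code.fix f).eval x ↔ ∃ x',
      Relation.ReflTransGen (fun x y => Sum.inr y ∈ F x) x x' ∧ Sum.inl y ∈ F x' := fun x y => by
    rw [← PFun.mem_fix_iff_reflTransGen, Code.fix_eval]
  constructor
  · rintro ⟨x, y, h, rfl, rfl⟩
    obtain ⟨x', h1, h2⟩ := (hfix x y).1 h
    refine ⟨encodeNats ℓ x', ⟨over_encodeNats x, ?_⟩,
      (fixStop_iff h01).2 ⟨x', y, (hl x' y).1 h2, rfl, rfl⟩⟩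
    exact h1.lift (encodeNats ℓ) fun a b hab =>
      (fixStep_iff h01).2 ⟨a, b, (hr a b).1 hab, rfl, rfl⟩
  · rintro ⟨u, ⟨-, h1⟩, h2⟩
    obtain ⟨x', y, h4, rfl, rfl⟩ := (fixStop_iff h01).1 h2
    have h3 : ∃ x, Relation.ReflTransGen (fun x y => Sum.inr y ∈ F x) x x' ∧
        v = encodeNats ℓ x := by
      induction h1 using Relation.ReflTransGen.head_induction_on with
      | refl => exact ⟨x', .refl, rfl⟩
      | head h _ ih =>
        obtain ⟨x, hx, rfl⟩ := ih
        obtain ⟨a, b, hab, rfl, hb⟩ := (fixStep_iff h01).1 h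
        rw [encodeNats_injective h01 hb] at hx
        exact ⟨a, .head ((hr a b).2 hab) hx, rfl⟩
    obtain ⟨x, hx, rfl⟩ := h3
    exact ⟨x, y, (hfix x y).2 ⟨x', hx, (hl x' y).2 h4⟩, rfl, rfl⟩

end Graph

/-! ### Certificates for the code constructors -/

section Check
open Turing.ToPartrec
variable {F : TheoryFamily} {cls : LangClass} {n : ℕ} {kind : Fin n → LetterKind}
  {ℓ : ℕ → Fin n}

theorem UDef.exists_eq_encodeNats (hstr : F.str = .we) (hcls : F.member = some cls)
    (h01 : ℓ 0 ≠ ℓ 1) (i : ℕ) : UDef F kind fun v => ∃ x, v i = encodeNats ℓ x := by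
  refine ((UDef.over hstr hcls ℓ 2 i).and (UDef.all (UDef.ne hstr [Sum.inl (i + 1)]
    [Sum.inl 0, Sum.inr (ℓ 0)]))).congr fun v => ?_
  rw [exists_eq_encodeNats_iff h01]
  simp [StrTerm.eval]

theorem checkable_codeGraph_zero' (hstr : F.str = .we) (hcls : F.member = some cls)
    (h01 : ℓ 0 ≠ ℓ 1) (d : ℕ) :
    Checkable F kind ℓ d fun v => CodeGraph ℓ .zero' (v 0) (v 1) :=
  .of_uDef <| ((UDef.exists_eq_encodeNats hstr hcls h01 0).and
    (UDef.eq hstr [Sum.inl 1] [Sum.inr (ℓ 1), Sum.inl 0])).congr fun v => by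
      simp [codeGraph_zero', StrTerm.eval]

theorem checkable_codeGraph_succ (hstr : F.str = .we) (hcls : F.member = some cls)
    (h01 : ℓ 0 ≠ ℓ 1) (d : ℕ) :
    Checkable F kind ℓ d fun v => CodeGraph ℓ .succ (v 0) (v 1) :=
  .of_uDef <| ((UDef.exists_eq_encodeNats hstr hcls h01 0).and
    (((UDef.eq hstr [Sum.inl 0] []).and
      (UDef.eq hstr [Sum.inl 1] [Sum.inr (ℓ 0), Sum.inr (ℓ 1)])).or
    (UDef.split hstr hcls (ℓ 1) 0 (UDef.eq hstr [Sum.inl 3]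
      [Sum.inr (ℓ 0), Sum.inl 0, Sum.inr (ℓ 1)])))).congr fun v => by
      simp [codeGraph_succ h01, StrTerm.eval]

theorem checkable_codeGraph_tail (hstr : F.str = .we) (hcls : F.member = some cls)
    (h01 : ℓ 0 ≠ ℓ 1) (d : ℕ) :
    Checkable F kind ℓ d fun v => CodeGraph ℓ .tail (v 0) (v 1) :=
  .of_uDef <| ((UDef.exists_eq_encodeNats hstr hcls h01 0).and
    (((UDef.eq hstr [Sum.inl 0] []).and (UDef.eq hstr [Sum.inl 1] [])).or
    (UDef.split hstr hcls (ℓ 1) 0 (UDef.eq hstr [Sum.inl 3] [Sum.inl 1])))).congr fun v => by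
      simp [codeGraph_tail h01, StrTerm.eval]

theorem checkable_codeGraph_cons (hstr : F.str = .we) (hcls : F.member = some cls) {d : ℕ}
    (hd : 2 ≤ d) (hℓ : Set.InjOn ℓ (Set.Iio (d + 4))) (h01 : ℓ 0 ≠ ℓ 1) {f fs : Code}
    (hf : Checkable F kind ℓ d fun v => CodeGraph ℓ f (v 0) (v 1))
    (hfs : Checkable F kind ℓ d fun v => CodeGraph ℓ fs (v 0) (v 1)) :
    Checkable F kind ℓ (d + 4) fun v => CodeGraph ℓ (.cons f fs) (v 0) (v 1) := by
  -- Under the two existential quantifiers, variables 0 and 1 are the results of `fs` and `f`, and 2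
  -- and 3 are input and output. Two conjunctions and two quantifiers account for the four new
  -- letters.
  have hlast : Checkable F kind ℓ d fun v => (v 1 = [] ∧ v 3 = ℓ 1 :: v 0) ∨
      ∃ a b, v 1 = a ++ ℓ 1 :: b ∧ ℓ 1 ∉ a ∧ v 3 = a ++ ℓ 1 :: v 0 :=
    .of_uDef <| (((UDef.eq hstr [Sum.inl 1] []).and
      (UDef.eq hstr [Sum.inl 3] [Sum.inr (ℓ 1), Sum.inl 0])).or (UDef.split hstr hcls (ℓ 1) 1
        (UDef.eq hstr [Sum.inl 5] [Sum.inl 0, Sum.inr (ℓ 1), Sum.inl 2]))).congr fun v => by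
        simp [StrTerm.eval]
  have h1 := ((hfs.rel 2 0).and hstr hcls (hℓ.mono (Set.Iio_subset_Iio (by omega))) hlast).ex
    hstr hcls (hℓ.mono (Set.Iio_subset_Iio (by omega))) fun u v h => h.1.over.2.mono (by omega)
  exact ((((hf.rel 1 0).mono (by omega)).and hstr hcls
    (hℓ.mono (Set.Iio_subset_Iio (by omega))) h1).ex hstr hcls hℓ
      fun u v h => h.1.over.2.mono (by omega)).congr fun v => codeGraph_cons h01

theorem checkable_codeGraph_comp (hstr : F.str = .we) (hcls : F.member = some cls) {d : ℕ}
    (hd : 2 ≤ d) (hℓ : Set.InjOn ℓ (Set.Iio (d + 2))) (h01 : ℓ 0 ≠ ℓ 1) {f g : Code}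
    (hf : Checkable F kind ℓ d fun v => CodeGraph ℓ f (v 0) (v 1))
    (hg : Checkable F kind ℓ d fun v => CodeGraph ℓ g (v 0) (v 1)) :
    Checkable F kind ℓ (d + 2) fun v => CodeGraph ℓ (.comp f g) (v 0) (v 1) :=
  (((hg.rel 1 0).and hstr hcls (hℓ.mono (Set.Iio_subset_Iio (by omega))) (hf.rel 0 2)).ex
    hstr hcls hℓ fun u v h => h.1.over.2.mono (by omega)).congr fun v => codeGraph_comp h01

theorem checkable_codeGraph_case (hstr : F.str = .we) (hcls : F.member = some cls) {d : ℕ}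
    (hd : 2 ≤ d) (hℓ : Set.InjOn ℓ (Set.Iio (d + 2))) {f g : Code}
    (hf : Checkable F kind ℓ d fun v => CodeGraph ℓ f (v 0) (v 1))
    (hg : Checkable F kind ℓ d fun v => CodeGraph ℓ g (v 0) (v 1)) :
    Checkable F kind ℓ (d + 2) fun v => CodeGraph ℓ (.case f g) (v 0) (v 1) := by
  have h0 : Checkable F kind ℓ d fun v => (v 1 = [] ∧ v 0 = []) ∨ v 1 = ℓ 1 :: v 0 :=
    .of_uDef <| (((UDef.eq hstr [Sum.inl 1] []).and (UDef.eq hstr [Sum.inl 0] [])).or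
      (UDef.eq hstr [Sum.inl 1] [Sum.inr (ℓ 1), Sum.inl 0])).congr fun v => by
        simp [StrTerm.eval]
  have h1 : Checkable F kind ℓ d fun v => v 1 = ℓ 0 :: v 0 ∧ v 0 ≠ [] :=
    .of_uDef <| ((UDef.eq hstr [Sum.inl 1] [Sum.inr (ℓ 0), Sum.inl 0]).and
      (UDef.ne hstr [Sum.inl 0] [])).congr fun v => by simp [StrTerm.eval]
  have hℓ' : Set.InjOn ℓ (Set.Iio (d + 1)) := hℓ.mono (Set.Iio_subset_Iio (by omega))
  exact (((h0.and hstr hcls hℓ' (hf.rel 0 2)).or (h1.and hstr hcls hℓ' (hg.rel 0 2))).ex hstr hcls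
    hℓ fun u v h => (h.elim (fun h => h.2.over.1) fun h => h.2.over.1).mono (by omega)).congr
      fun v => codeGraph_case

theorem checkable_codeGraph_fix (hstr : F.str = .we) (hcls : F.member = some cls) {d : ℕ}
    (hd : 2 ≤ d) (hℓ : Set.InjOn ℓ (Set.Iio (d + 7))) (h01 : ℓ 0 ≠ ℓ 1) {f : Code}
    (hf : Checkable F kind ℓ d fun v => CodeGraph ℓ f (v 0) (v 1)) :
    Checkable F kind ℓ (d + 7) fun v => CodeGraph ℓ (.fix f) (v 0) (v 1) := by
  -- The letters are spent as follows: two on a round of the loop, two on the chain, one on the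
  -- bound `Over ℓ 2`, and two on joining the chain to the last round and quantifying over the word
  -- between.
  have hℓ' : ∀ i ≤ 7, Set.InjOn ℓ (Set.Iio (d + i)) := fun i hi =>
    hℓ.mono (Set.Iio_subset_Iio (by omega))
  have h1 : Checkable F kind ℓ d fun v =>
      ∃ a b, v 0 = a ++ ℓ 1 :: b ∧ ℓ 1 ∉ a ∧ (a ≠ [] ∧ v 2 = b) :=
    .of_uDef <| (UDef.split hstr hcls (ℓ 1) 0 ((UDef.ne hstr [Sum.inl 0] []).and
      (UDef.eq hstr [Sum.inl 4] [Sum.inl 1]))).congr fun v => by simp [StrTerm.eval]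
  have h2 : Checkable F kind ℓ d fun v => (v 0 = [] ∧ v 2 = []) ∨ v 0 = ℓ 1 :: v 2 :=
    .of_uDef <| (((UDef.eq hstr [Sum.inl 0] []).and (UDef.eq hstr [Sum.inl 2] [])).or
      (UDef.eq hstr [Sum.inl 0] [Sum.inr (ℓ 1), Sum.inl 2])).congr fun v => by
        simp [StrTerm.eval]
  have hstep : Checkable F kind ℓ (d + 2) fun v => FixStep ℓ f (v 0) (v 1) :=
    ((hf.rel 1 0).and hstr hcls (hℓ' 1 (by omega)) h1).ex hstr hcls (hℓ' 2 (by omega))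
      fun u v h => h.1.over.2.mono (by omega)
  have hfinal : Checkable F kind ℓ (d + 2) fun v => FixStop ℓ f (v 0) (v 1) :=
    ((hf.rel 1 0).and hstr hcls (hℓ' 1 (by omega)) h2).ex hstr hcls (hℓ' 2 (by omega))
      fun u v h => h.1.over.2.mono (by omega)
  have hover : ∀ x y, FixStep ℓ f x y → Over ℓ 2 x ∧ Over ℓ 2 y := by
    intro x y h
    obtain ⟨x, y, -, rfl, rfl⟩ := (fixStep_iff h01).1 h
    exact ⟨over_encodeNats x, over_encodeNats y⟩
  have hchain := ((Checkable.of_uDef (d := d + 4) (UDef.over (kind := kind) hstr hcls ℓ 2 0)).and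
    hstr hcls (hℓ' 5 (by omega)) (hstep.reflTransGen hstr hcls (hℓ' 4 (by omega)) fun x y h =>
      ⟨(hover x y h).1.mono (by omega), (hover x y h).2.mono (by omega)⟩)).congr
    (Q := fun v => Over ℓ 2 (v 0) ∧ Relation.ReflTransGen (FixStep ℓ f) (v 0) (v 1))
    fun v => ⟨fun h => ⟨h.1, h.1.mono (by omega), h.2⟩, fun h => ⟨h.1, h.2.2⟩⟩
  exact ((Checkable.rel
    (R := fun x y => Over ℓ 2 x ∧ Relation.ReflTransGen (FixStep ℓ f) x y) hchain 1 0).and hstr hcls (hℓ' 6 (by omega))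
    ((hfinal.rel 0 2).mono (by omega))).ex hstr hcls hℓ (fun u v h => by
      obtain ⟨x, y, -, hu, -⟩ := (fixStop_iff h01).1 h.2
      rw [vcons_zero] at hu
      rw [hu]
      exact (over_encodeNats x).mono (by omega)) |>.congr fun v => codeGraph_fix h01

/-- Computations can be certified, with certificates over an alphabet whose size depends only on the
code. -/
theorem exists_checkable_codeGraph (hstr : F.str = .we) (hcls : F.member = some cls) (c : Code) :
    ∃ d ≥ 2, ∀ (n : ℕ) (kind : Fin n → LetterKind) (ℓ : ℕ → Fin n), Set.InjOn ℓ (Set.Iio d) →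
      Checkable F kind ℓ d fun v => CodeGraph ℓ c (v 0) (v 1) := by
  have hne : ∀ {d n : ℕ} {ℓ : ℕ → Fin n}, 2 ≤ d → Set.InjOn ℓ (Set.Iio d) → ℓ 0 ≠ ℓ 1 := by
    intro d n ℓ hd hℓ h
    have := hℓ (show 0 ∈ Set.Iio d by simp; omega) (show 1 ∈ Set.Iio d by simp; omega) h
    omega
  have hmono : ∀ {d d' n : ℕ} {ℓ : ℕ → Fin n}, d' ≤ d → Set.InjOn ℓ (Set.Iio d) →
      Set.InjOn ℓ (Set.Iio d') := fun h hℓ => hℓ.mono (Set.Iio_subset_Iio h)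
  induction c with
  | zero' => exact ⟨2, le_rfl, fun n kind ℓ hℓ =>
      checkable_codeGraph_zero' hstr hcls (hne le_rfl hℓ) 2⟩
  | succ => exact ⟨2, le_rfl, fun n kind ℓ hℓ =>
      checkable_codeGraph_succ hstr hcls (hne le_rfl hℓ) 2⟩
  | tail => exact ⟨2, le_rfl, fun n kind ℓ hℓ =>
      checkable_codeGraph_tail hstr hcls (hne le_rfl hℓ) 2⟩
  | cons f g ihf ihg =>
    obtain ⟨d, hd, hf⟩ := ihf
    obtain ⟨d', hd', hg⟩ := ihg
    exact ⟨max d d' + 4, by omega, fun n kind ℓ hℓ =>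
      checkable_codeGraph_cons hstr hcls (le_max_of_le_left hd) hℓ (hne (by omega) hℓ)
        ((hf n kind ℓ (hmono (by omega) hℓ)).mono (le_max_left _ _))
        ((hg n kind ℓ (hmono (by omega) hℓ)).mono (le_max_right _ _))⟩
  | comp f g ihf ihg =>
    obtain ⟨d, hd, hf⟩ := ihf
    obtain ⟨d', hd', hg⟩ := ihg
    exact ⟨max d d' + 2, by omega, fun n kind ℓ hℓ =>
      checkable_codeGraph_comp hstr hcls (le_max_of_le_left hd) hℓ (hne (by omega) hℓ)
        ((hf n kind ℓ (hmono (by omega) hℓ)).mono (le_max_left _ _))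
        ((hg n kind ℓ (hmono (by omega) hℓ)).mono (le_max_right _ _))⟩
  | case f g ihf ihg =>
    obtain ⟨d, hd, hf⟩ := ihf
    obtain ⟨d', hd', hg⟩ := ihg
    exact ⟨max d d' + 2, by omega, fun n kind ℓ hℓ =>
      checkable_codeGraph_case hstr hcls (le_max_of_le_left hd) hℓ
        ((hf n kind ℓ (hmono (by omega) hℓ)).mono (le_max_left _ _))
        ((hg n kind ℓ (hmono (by omega) hℓ)).mono (le_max_right _ _))⟩
  | fix f ihf =>
    obtain ⟨d, hd, hf⟩ := ihf
    exact ⟨d + 7, by omega, fun n kind ℓ hℓ =>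
      checkable_codeGraph_fix hstr hcls hd hℓ (hne (by omega) hℓ)
        (hf n kind ℓ (hmono (by omega) hℓ))⟩

end Check

/-! ### Codes determine descriptions -/

section CodeInjective
variable {α : Type}

theorem NFATable.code_injective : Function.Injective (NFATable.code : NFATable α → _) := by
  rintro ⟨⟩ ⟨⟩ h
  simpa [NFATable.code] using h

theorem VPATable.code_injective : Function.Injective (VPATable.code : VPATable α → _) := by
  rintro ⟨⟩ ⟨⟩ h
  simpa [VPATable.code] using h

theorem DPDATable.code_injective : Function.Injective (DPDATable.code : DPDATable α → _) := by
  rintro ⟨⟩ ⟨⟩ h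
  simpa [DPDATable.code] using h

theorem LangDesc.code_injective : Function.Injective (LangDesc.code : LangDesc α → _) := by
  rintro (M | M | M) (M' | M' | M') h <;>
    simp only [LangDesc.code, Sum.inl.injEq, Sum.inr.injEq, reduceCtorEq] at h
  · rw [NFATable.code_injective h]
  · rw [VPATable.code_injective h]
  · rw [DPDATable.code_injective h]

theorem Atom.code_injective : Function.Injective (Atom.code : Atom α → _) := by
  rintro (_ | _ | _) (_ | _ | _) h <;>
    simp only [Atom.code, Sum.inl.injEq, Sum.inr.injEq, Prod.mk.injEq, reduceCtorEq] at h
  · rw [h.1, LangDesc.code_injective h.2]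
  · rw [h.1, h.2]
  · rw [h.1, h.2]

/-- Prefix notation is uniquely readable. The trailing lists make the induction work, since the code
of a left subformula is followed by that of the right one. -/
theorem StrFormula.eq_of_code_append_eq (f : StrFormula α) : ∀ (g : StrFormula α)
    (l l' : List (Token α)), f.code ++ l = g.code ++ l' → f = g ∧ l = l' := by
  induction f with
  | atom A =>
    intro g l l' h
    cases g <;> simp [StrFormula.code] at h
    exact ⟨by rw [Atom.code_injective h.1], h.2⟩
  | neg f ih =>
    intro g l l' h
    cases g <;> simp [StrFormula.code] at h
    obtain ⟨rfl, rfl⟩ := ih _ _ _ h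
    exact ⟨rfl, rfl⟩
  | and f g ihf ihg | or f g ihf ihg | imp f g ihf ihg | iff f g ihf ihg =>
    intro g l l' h
    cases g <;> simp [StrFormula.code] at h
    obtain ⟨rfl, h'⟩ := ihf _ _ _ h
    obtain ⟨rfl, rfl⟩ := ihg _ _ _ h'
    exact ⟨rfl, rfl⟩

theorem Description.code_injective {F : TheoryFamily} :
    Function.Injective (Description.code : Description F α → _) := by
  rintro ⟨f, hf, x, hx⟩ ⟨g, hg, y, hy⟩ h
  obtain ⟨h1, rfl⟩ := Prod.mk.inj h
  obtain ⟨rfl, -⟩ := f.eq_of_code_append_eq g [] [] (by simpa using h1)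
  rfl

end CodeInjective

/-! ### Renaming is computable -/

def AtomCode.rename {α : Type} (ρ : ℕ → ℕ) : AtomCode α → AtomCode α :=
  Sum.map (Prod.map (StrTerm.rename ρ) id) (Sum.map (Prod.map (LenTerm.rename ρ) (LenTerm.rename ρ))
    (Prod.map (StrTerm.rename ρ) (StrTerm.rename ρ)))

def Token.rename {α : Type} (ρ : ℕ → ℕ) : Token α → Token α := Sum.map (AtomCode.rename ρ) id

theorem StrFormula.code_rename {α : Type} (ρ : ℕ → ℕ) (f : StrFormula α) :
    (f.rename ρ).code = f.code.map (Token.rename ρ) := by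
  induction f with
  | atom A => cases A <;> rfl
  | neg f ih => simp [StrFormula.rename, StrFormula.code, ih, Token.rename]
  | and f g ihf ihg | or f g ihf ihg | imp f g ihf ihg | iff f g ihf ihg =>
    simp [StrFormula.rename, StrFormula.code, ihf, ihg, Token.rename]

section PrimrecRename

theorem Primrec.sumMap {α β γ δ : Type*} [Primcodable α] [Primcodable β] [Primcodable γ]
    [Primcodable δ] {f : α → γ} {g : β → δ} (hf : Primrec f) (hg : Primrec g) :
    Primrec (Sum.map f g) :=
  (Primrec.sumCasesOn Primrec.id (Primrec.sumInl.comp (hf.comp Primrec.snd)).to₂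
    (Primrec.sumInr.comp (hg.comp Primrec.snd)).to₂).of_eq fun x => by cases x <;> rfl

theorem Primrec.prodMap {α β γ δ : Type*} [Primcodable α] [Primcodable β] [Primcodable γ]
    [Primcodable δ] {f : α → γ} {g : β → δ} (hf : Primrec f) (hg : Primrec g) :
    Primrec (Prod.map f g) :=
  (hf.comp Primrec.fst).pair (hg.comp Primrec.snd)

theorem Primrec.list_map_const {α β : Type*} [Primcodable α] [Primcodable β] {f : α → β}
    (hf : Primrec f) : Primrec (List.map f) :=
  Primrec.list_map Primrec.id (hf.comp Primrec.snd)

theorem Primrec.list_replicate {α : Type*} [Primcodable α] (a : α) :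
    Primrec fun m : ℕ => List.replicate m a :=
  (Primrec.list_map Primrec.list_range (Primrec₂.const a)).of_eq fun m => by simp

variable {α : Type} [Primcodable α] {ρ : ℕ → ℕ}

theorem StrTerm.primrec_rename (hρ : Primrec ρ) :
    Primrec (StrTerm.rename ρ : StrTerm α → StrTerm α) :=
  Primrec.list_map_const (Primrec.sumMap hρ Primrec.id)

theorem LenTerm.primrec_rename (hρ : Primrec ρ) :
    Primrec (LenTerm.rename ρ : LenTerm α → LenTerm α) :=
  Primrec.prodMap Primrec.id (Primrec.list_map_const
    (Primrec.prodMap Primrec.id (Primrec.sumMap hρ Primrec.id)))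

theorem Token.primrec_rename (hρ : Primrec ρ) : Primrec (Token.rename ρ : Token α → Token α) :=
  Primrec.sumMap (Primrec.sumMap (Primrec.prodMap (StrTerm.primrec_rename hρ) Primrec.id)
    (Primrec.sumMap (Primrec.prodMap (LenTerm.primrec_rename hρ) (LenTerm.primrec_rename hρ))
      (Primrec.prodMap (StrTerm.primrec_rename hρ) (StrTerm.primrec_rename hρ)))) Primrec.id

end PrimrecRename

/-! ### Closure under union and under products with regular languages -/

section Closure
variable {F : TheoryFamily} {cls : LangClass} {n : ℕ}

theorem Description.exists_lang_eq_of_isRegular (hstr : F.str = .we) (hcls : F.member = some cls)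
    (kind : Fin n → LetterKind) {R : Language (Fin n)} (hR : R.IsRegular) :
    ∃ d : Description F (Fin n), d.lang kind = R := by
  obtain ⟨M, rfl⟩ := hR.exists_nfaTable
  refine ⟨⟨.atom (.mem [Sum.inl 0] (M.toLangDesc cls)), ⟨by simpa using hcls, by simp [hstr]⟩, 0,
    List.mem_singleton.2 rfl⟩, ?_⟩
  ext w
  simp only [Description.lang, StrFormula.Holds, Atom.Holds, StrTerm.eval,
    NFATable.lang_toLangDesc, List.flatMap_cons, List.flatMap_nil, Sum.elim_inl, List.append_nil]
  constructor
  · rintro ⟨h, hw, rfl⟩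
    exact hw
  · intro hw
    exact ⟨fun _ => w, hw, rfl⟩

/-- The token of a word equation. -/
def Token.eqn {α : Type} (s t : StrTerm α) : Token α := Sum.inl (Sum.inr (Sum.inr (s, t)))

/-- The token of a membership constraint. -/
def Token.mem {α : Type} (s : StrTerm α) (L : LangCode α) : Token α := Sum.inl (Sum.inl (s, L))

theorem Token.primrec_eqn {α : Type} [Primcodable α] :
    Primrec₂ (Token.eqn : StrTerm α → StrTerm α → Token α) :=
  Primrec.sumInl.comp (Primrec.sumInr.comp (Primrec.sumInr.comp Primrec.id))

theorem Token.primrec_mem {α : Type} [Primcodable α] :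
    Primrec₂ (Token.mem : StrTerm α → LangCode α → Token α) :=
  Primrec.sumInl.comp (Primrec.sumInl.comp Primrec.id)

/-- The string term `x` for a variable `x`. -/
theorem StrTerm.primrec_var {α : Type} [Primcodable α] :
    Primrec fun x : ℕ => ([Sum.inl x] : StrTerm α) :=
  Primrec.list_cons.comp Primrec.sumInl (Primrec.const [])

def DescriptionCode.unionPart {α : Type} (p : DescriptionCode α) : List (Token α) :=
  Sum.inr 1 :: (p.1.map (Token.rename Nat.succ) ++ [Token.eqn [Sum.inl 0] [Sum.inl p.2.succ]])

/-- Both formulas are shifted by the same renaming and may share variables, because an existential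
quantifier distributes over a disjunction. Variable 0, freed by the shift, carries the word. -/
def DescriptionCode.union {α : Type} (p q : DescriptionCode α) : DescriptionCode α :=
  (Sum.inr 2 :: (DescriptionCode.unionPart p ++ DescriptionCode.unionPart q), 0)

theorem DescriptionCode.primrec_unionPart {α : Type} [Primcodable α] :
    Primrec (DescriptionCode.unionPart : DescriptionCode α → List (Token α)) := by
  refine Primrec.list_cons.comp (Primrec.const (Sum.inr 1)) (Primrec.list_append.comp
    ((Primrec.list_map_const (Token.primrec_rename Primrec.succ)).comp Primrec.fst)
    (Primrec.list_cons.comp (Token.primrec_eqn.comp (Primrec.const [Sum.inl 0]) ?_)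
      (Primrec.const [])))
  exact StrTerm.primrec_var.comp (Primrec.succ.comp Primrec.snd)

theorem DescriptionCode.primrec_union {α : Type} [Primcodable α] :
    Primrec₂ (DescriptionCode.union : DescriptionCode α → DescriptionCode α → _) :=
  (Primrec.list_cons.comp (Primrec.const (Sum.inr 2)) (Primrec.list_append.comp
    (DescriptionCode.primrec_unionPart.comp Primrec.fst)
    (DescriptionCode.primrec_unionPart.comp Primrec.snd))).pair (Primrec.const 0)

theorem Description.exists_union (hstr : F.str = .we) (kind : Fin n → LetterKind)
    (d₁ d₂ : Description F (Fin n)) : ∃ d : Description F (Fin n),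
      DescriptionCode.union d₁.code d₂.code = d.code ∧ d.lang kind = d₁.lang kind + d₂.lang kind := by
  obtain ⟨f, hf, x, hx⟩ := d₁
  obtain ⟨g, hg, y, hy⟩ := d₂
  refine ⟨⟨.or (.and (f.rename Nat.succ) (.atom (.eqn [Sum.inl 0] [Sum.inl x.succ])))
    (.and (g.rename Nat.succ) (.atom (.eqn [Sum.inl 0] [Sum.inl y.succ]))),
    ⟨⟨StrFormula.rename_mem_theory hf, hstr⟩, StrFormula.rename_mem_theory hg, hstr⟩, 0,
    Or.inl (Or.inr (Or.inl (List.mem_singleton.2 rfl)))⟩, ?_, ?_⟩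
  · simp [Description.code, DescriptionCode.union, DescriptionCode.unionPart, StrFormula.code,
      StrFormula.code_rename, Atom.code, Token.eqn]
  · ext w
    rw [Language.mem_add]
    change (∃ h : ℕ → List (Fin n), _ ∧ _) ↔ (∃ h : ℕ → List (Fin n), _ ∧ _) ∨
      ∃ h : ℕ → List (Fin n), _ ∧ _
    simp only [StrFormula.Holds, StrFormula.holds_rename, Atom.Holds, StrTerm.eval, List.flatMap_cons, List.flatMap_nil, Sum.elim_inl, List.append_nil]
    constructor
    · rintro ⟨h, ⟨h1, h2⟩ | ⟨h1, h2⟩, rfl⟩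
      · exact Or.inl ⟨_, h1, h2.symm⟩
      · exact Or.inr ⟨_, h1, h2.symm⟩
    · rintro (⟨h, h1, rfl⟩ | ⟨h, h1, rfl⟩)
      · exact ⟨vcons (h x) h, Or.inl ⟨h1, rfl⟩, rfl⟩
      · exact ⟨vcons (h y) h, Or.inr ⟨h1, rfl⟩, rfl⟩

/-- The formula for a product with a regular language; `s` is the product as a term in variables
`1`, for a word of the regular language, and `x + 2`. -/
def DescriptionCode.product (cls : LangClass) (s : ℕ → StrTerm (Fin n))
    (p : DescriptionCode (Fin n)) (M : NFACode (Fin n)) : DescriptionCode (Fin n) :=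
  (Sum.inr 1 :: (p.1.map (Token.rename (Nat.succ ∘ Nat.succ)) ++ Sum.inr 1 ::
    [Token.mem [Sum.inl 1] (NFACode.toLangCode cls M), Token.eqn [Sum.inl 0] (s (p.2 + 2))]), 0)

theorem DescriptionCode.primrec_product (cls : LangClass) {s : ℕ → StrTerm (Fin n)}
    (hs : Primrec s) : Primrec₂ (DescriptionCode.product cls s) := by
  refine (Primrec.list_cons.comp (Primrec.const (Sum.inr 1)) (Primrec.list_append.comp
    ((Primrec.list_map_const (Token.primrec_rename (Primrec.succ.comp Primrec.succ))).comp
      (Primrec.fst.comp Primrec.fst)) (Primrec.list_cons.comp (Primrec.const (Sum.inr 1))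
      (Primrec.list_cons.comp (Token.primrec_mem.comp (Primrec.const [Sum.inl 1]) ?_)
        (Primrec.list_cons.comp (Token.primrec_eqn.comp (Primrec.const [Sum.inl 0]) ?_)
          (Primrec.const [])))))).pair (Primrec.const 0)
  · exact (NFACode.primrec_toLangCode cls).comp Primrec.snd
  · exact hs.comp (Primrec.succ.comp (Primrec.succ.comp (Primrec.snd.comp Primrec.fst)))

/-- One construction serves products on both sides; they differ only in the order of two variables
in `s`. -/
theorem Description.exists_product (hstr : F.str = .we) (hcls : F.member = some cls)
    (kind : Fin n → LetterKind) (s : ℕ → StrTerm (Fin n)) (d : Description F (Fin n))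
    (M : NFATable (Fin n)) : ∃ d' : Description F (Fin n),
      DescriptionCode.product cls s d.code M.code = d'.code ∧
        ∀ w, w ∈ d'.lang kind ↔ ∃ h : ℕ → List (Fin n), d.formula.Holds kind (h ∘ (· + 2)) ∧
          h 1 ∈ M.lang ∧ h 0 = StrTerm.eval h (s (d.var + 2)) ∧ h 0 = w := by
  obtain ⟨f, hf, x, hx⟩ := d
  refine ⟨⟨.and (f.rename (Nat.succ ∘ Nat.succ)) (.and
    (.atom (.mem [Sum.inl 1] (M.toLangDesc cls))) (.atom (.eqn [Sum.inl 0] (s (x + 2))))),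
    ⟨StrFormula.rename_mem_theory hf, ⟨by simpa using hcls, by simp [hstr]⟩, hstr⟩, 0,
    Or.inr (Or.inr (Or.inl (List.mem_singleton.2 rfl)))⟩, ?_, fun w => ?_⟩
  · simp [Description.code, DescriptionCode.product, StrFormula.code, StrFormula.code_rename,
      Atom.code, Token.eqn, Token.mem, NFATable.code_toLangDesc]
  · change (∃ h : ℕ → List (Fin n), _ ∧ _) ↔ _
    refine exists_congr fun h => ?_
    simp only [StrFormula.Holds, StrFormula.holds_rename, Atom.Holds, NFATable.lang_toLangDesc,
      and_assoc]
    simp only [StrTerm.eval, List.flatMap_cons, List.flatMap_nil, Sum.elim_inl, List.append_nil]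
    rfl

theorem Description.exists_mul_regular (hstr : F.str = .we) (hcls : F.member = some cls)
    (kind : Fin n → LetterKind) (d : Description F (Fin n)) (M : NFATable (Fin n)) :
    ∃ d' : Description F (Fin n),
      DescriptionCode.product cls (fun x => [Sum.inl x, Sum.inl 1]) d.code M.code = d'.code ∧
        d'.lang kind = d.lang kind * M.lang := by
  obtain ⟨d', hd', h⟩ := d.exists_product hstr hcls kind (fun x => [Sum.inl x, Sum.inl 1]) M
  refine ⟨d', hd', ?_⟩
  ext w
  rw [h, Language.mem_mul]
  constructor
  · rintro ⟨h, h1, h2, h3, rfl⟩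
    exact ⟨_, ⟨_, h1, rfl⟩, _, h2, by simpa [StrTerm.eval] using h3.symm⟩
  · rintro ⟨_, ⟨h, h1, rfl⟩, w, hw, rfl⟩
    exact ⟨vcons (h d.var ++ w) (vcons w h), h1, hw, by simp [StrTerm.eval], rfl⟩

theorem Description.exists_regular_mul (hstr : F.str = .we) (hcls : F.member = some cls)
    (kind : Fin n → LetterKind) (d : Description F (Fin n)) (M : NFATable (Fin n)) :
    ∃ d' : Description F (Fin n),
      DescriptionCode.product cls (fun x => [Sum.inl 1, Sum.inl x]) d.code M.code = d'.code ∧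
        d'.lang kind = M.lang * d.lang kind := by
  obtain ⟨d', hd', h⟩ := d.exists_product hstr hcls kind (fun x => [Sum.inl 1, Sum.inl x]) M
  refine ⟨d', hd', ?_⟩
  ext w
  rw [h, Language.mem_mul]
  constructor
  · rintro ⟨h, h1, h2, h3, rfl⟩
    exact ⟨_, h2, _, ⟨_, h1, rfl⟩, by simpa [StrTerm.eval] using h3.symm⟩
  · rintro ⟨w, hw, _, ⟨h, h1, rfl⟩, rfl⟩
    exact ⟨vcons (w ++ h d.var) (vcons w h), h1, hw, by simp [StrTerm.eval], rfl⟩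

end Closure

/-! ### Undecidability of universality -/

/-- There is a fixed program whose halting problem is undecidable. -/
theorem exists_code_halting_undecidable : ∃ c : Turing.ToPartrec.Code,
    ¬ ComputablePred fun m : ℕ => (c.eval [m]).Dom := by
  -- A universal program: it runs program number `m` on input 0, so the halting problem on input 0
  -- reduces to its halting problem.
  let f : ℕ →. ℕ := fun m => Nat.Partrec.Code.eval (Denumerable.ofNat Nat.Partrec.Code m) 0
  have hf : Partrec f := Nat.Partrec.Code.eval_part.comp (Computable.ofNat _) (Computable.const 0)
  obtain ⟨c, hc⟩ := Turing.ToPartrec.Code.exists_code (Nat.Partrec'.part_iff₁.2 hf)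
  refine ⟨c, fun h => ComputablePred.halting_problem 0 ?_⟩
  obtain ⟨g, hg, hgp⟩ := ComputablePred.computable_iff.1 h
  refine ComputablePred.computable_iff.2 ⟨_, hg.comp Computable.encode, ?_⟩
  funext e
  rw [← congrFun hgp (Encodable.encode e)]
  have := hc (Encodable.encode e ::ᵥ List.Vector.nil)
  simp only [List.Vector.cons_val, List.Vector.head_cons, f, Denumerable.ofNat_encode] at this
  change _ = (c.eval [Encodable.encode e]).Dom
  rw [show c.eval [Encodable.encode e] = _ from this]
  rfl

/-- Letters that avoid a given one. -/
theorem exists_letters_ne {n d : ℕ} (hd : d + 1 ≤ n) (hash : Fin n) :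
    ∃ ℓ : ℕ → Fin n, Set.InjOn ℓ (Set.Iio d) ∧ ∀ i < d, ℓ i ≠ hash := by
  obtain ⟨n, rfl⟩ : ∃ m, n = m + 1 := ⟨n - 1, by omega⟩
  -- `succAbove` enumerates the letters other than `hash`; the default value is never reached for
  -- indices below `d`.
  refine ⟨fun i => if h : i < n then hash.succAbove ⟨i, h⟩ else hash, fun i hi j hj h => ?_,
    fun i hi => ?_⟩
  · have hi' : i < n := lt_of_lt_of_le hi (by omega)
    have hj' : j < n := lt_of_lt_of_le hj (by omega)
    simpa [hi', hj'] using h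
  · have hi' : i < n := by omega
    simp [hi', Fin.succAbove_ne]

theorem Description.universality_undecidable {F : TheoryFamily} {cls : LangClass}
    (hstr : F.str = .we) (hcls : F.member = some cls) :
    ∃ N : ℕ, ∀ n : ℕ, N ≤ n → ∀ (kind : Fin n → LetterKind) (hash : Fin n),
      ¬ ∃ dec : DescriptionCode (Fin n) → Bool, Computable dec ∧
        ∀ d : Description F (Fin n), dec d.code = true ↔
          d.lang kind = {w : List (Fin n) | hash ∉ w} := by
  obtain ⟨c, hc⟩ := exists_code_halting_undecidable
  obtain ⟨d, hd, hcheck⟩ := exists_checkable_codeGraph hstr hcls c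
  -- The code uses `d` letters, quantifying over its output one more, and `hash` must be avoided.
  refine ⟨d + 2, fun n hn kind hash => ?_⟩
  rintro ⟨dec, hdec, hspec⟩
  obtain ⟨ℓ, hℓ, hhash⟩ := exists_letters_ne hn hash
  have h01 : ℓ 0 ≠ ℓ 1 := fun h => by
    have := hℓ (show 0 ∈ Set.Iio (d + 1) by simp) (show 1 ∈ Set.Iio (d + 1) by simp; omega) h
    omega
  obtain ⟨G, hG, h1, h2⟩ := ((hcheck n kind ℓ (hℓ.mono (Set.Iio_subset_Iio (by omega)))).rel 1
    0).ex hstr hcls hℓ fun u v h => h.over.2.mono hd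
  -- After this renaming the checker depends only on variable 0, the certificate, and variable 1,
  -- the input, so one word equation fixes the whole instance.
  obtain ⟨f, hf, hfG⟩ := hG.comp_rename (vcons 0 fun _ => 1)
  let e : ℕ → ℕ := fun i => Equiv.natSumNatEquivNat (Sum.inl i)
  let M : NFATable (Fin n) := NFATable.lettersIn ((List.finRange n).filter (· ≠ hash))
  have hM : ∀ w, w ∈ M.lang ↔ hash ∉ w := fun w => by
    simp [M, NFATable.mem_lang_lettersIn]
    exact ⟨fun h hh => h _ hh rfl, fun h a ha e => h (e ▸ ha)⟩
  let input : ℕ → StrTerm (Fin n) := fun m =>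
    List.replicate m (Sum.inr (ℓ 0)) ++ [Sum.inr (ℓ 1)]
  have hinput : ∀ m h, StrTerm.eval h (input m) = encodeNats ℓ [m] := fun m h => by
    simp [input, StrTerm.eval, encodeNats]
    induction m with
    | zero => rfl
    | succ m ih => simp [List.replicate_succ, ih]
  -- Under the negation the universal auxiliary variables of `f` become existential, which is how a
  -- description reads its variables. The word itself is `e 0` and the input is `e 1`.
  let D : ℕ → Description F (Fin n) := fun m =>
    { formula := .and (.atom (.mem [Sum.inl (e 0)] (M.toLangDesc cls)))
        (.and (.atom (.eqn [Sum.inl (e 1)] (input m))) (.neg f))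
      mem_theory := ⟨⟨by simpa using hcls, by simp [hstr]⟩, hstr, hf⟩
      var := e 0
      occurs := Or.inl (List.mem_singleton.2 rfl) }
  have hlang : ∀ m w, w ∈ (D m).lang kind ↔
      hash ∉ w ∧ ¬ G (vcons w fun _ => encodeNats ℓ [m]) := by
    intro m w
    have key : ∀ v : ℕ → List (Fin n), v 0 = w → v 1 = encodeNats ℓ [m] →
        ((∀ b, f.Holds kind (vmerge v b)) ↔ G (vcons w fun _ => encodeNats ℓ [m])) := by
      rintro v rfl hv
      rw [← hfG]
      beta_reduce
      rw [comp_vcons]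
      simp only [Function.comp_def, hv]
    change (∃ h : ℕ → List (Fin n), (_ ∧ _ ∧ ¬ _) ∧ _) ↔ _
    simp only [StrFormula.Holds, Atom.Holds, NFATable.lang_toLangDesc, hM, hinput]
    simp only [StrTerm.eval, List.flatMap_cons, List.flatMap_nil, Sum.elim_inl, List.append_nil]
    constructor
    · rintro ⟨h, ⟨hh, hin, hfh⟩, rfl⟩
      refine ⟨hh, fun hGw => hfh ?_⟩
      have := (key (fun i => h (e i)) rfl hin).2 hGw
        fun i => h (Equiv.natSumNatEquivNat (Sum.inr i))
      convert this using 1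
      funext i
      obtain ⟨j | j, rfl⟩ := Equiv.natSumNatEquivNat.surjective i <;> simp [vmerge, e]
    · rintro ⟨hh, hGw⟩
      rw [← key (vcons w fun _ => encodeNats ℓ [m]) rfl rfl, not_forall] at hGw
      obtain ⟨b, hb⟩ := hGw
      have h0 := vmerge_inl (vcons w fun _ => encodeNats ℓ [m]) b 0
      have h1 := vmerge_inl (vcons w fun _ => encodeNats ℓ [m]) b 1
      exact ⟨_, ⟨by rwa [h0], h1, hb⟩, h0⟩
  have huniv : ∀ m, (D m).lang kind = {w : List (Fin n) | hash ∉ w} ↔ ¬ (c.eval [m]).Dom := by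
    intro m
    constructor
    · intro h hdom
      -- A halting computation has a certificate over the chosen letters. It avoids `hash`, so it is
      -- a word missing from the language.
      obtain ⟨t, ht, hGt⟩ := h1 (fun _ => encodeNats ℓ [m])
        ⟨encodeNats ℓ ((c.eval [m]).get hdom), [m], _, Part.get_mem hdom, rfl, rfl⟩
      have hht : hash ∉ t := fun hh => by
        obtain ⟨i, hi, rfl⟩ := ht _ hh
        exact hhash i hi rfl
      have : t ∈ (D m).lang kind := by
        rw [h]
        exact hht
      exact ((hlang m t).1 this).2 hGt
    · intro h
      ext w
      refine (hlang m w).trans (and_iff_left fun hGw => h ?_)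
      obtain ⟨u, hu⟩ := h2 _ _ hGw
      obtain ⟨y, hy, -⟩ := (codeGraph_encodeNats_left h01).1 hu
      exact Part.dom_iff_mem.2 ⟨y, hy⟩
  have hcode : Computable fun m => (D m).code := by
    have hin : Primrec input := Primrec.list_append.comp
      (Primrec.list_replicate _) (Primrec.const _)
    have : Primrec fun m => (((Sum.inr 1 :: Token.mem [Sum.inl (e 0)] (M.toLangDesc cls).code ::
        Sum.inr 1 :: Token.eqn [Sum.inl (e 1)] (input m) :: Sum.inr 0 :: f.code), e 0) :
        DescriptionCode (Fin n)) :=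
      (Primrec.list_cons.comp (Primrec.const _) (Primrec.list_cons.comp (Primrec.const _)
        (Primrec.list_cons.comp (Primrec.const _) (Primrec.list_cons.comp
          (Token.primrec_eqn.comp (Primrec.const _) hin) (Primrec.const _))))).pair
        (Primrec.const _)
    exact this.to_comp
  refine hc (ComputablePred.computable_iff.2 ⟨fun m => !dec (D m).code,
    Primrec.not.to_comp.comp (hdec.comp hcode), ?_⟩)
  funext m
  have h := (hspec (D m)).trans (huniv m)
  rw [Bool.not_eq_true', ← Bool.not_eq_true, h, not_not]

theorem mainTheorem9 (F : TheoryFamily) (hF : F.Contains TheoryFamily.weReg) :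
    ∃ N : ℕ, ∀ n : ℕ, N ≤ n → ∀ (kind : Fin n → LetterKind) (hash : Fin n),
      GreibachConditions (fun d : Description F (Fin n) => d.lang kind)
        (fun d : Description F (Fin n) => d.code) hash := by
  obtain ⟨cls, hcls, -⟩ := hF.1 .reg rfl
  have hstr : F.str = .we := by
    have h : 2 ≤ F.str.rank := hF.2.2
    cases hs : F.str <;> simp [hs, StrLevel.rank] at h ⊢
  obtain ⟨N, hN⟩ := Description.universality_undecidable hstr hcls
  have hvar : ∀ n, Primrec fun x : ℕ => (Sum.inl x : ℕ ⊕ Fin n) := fun n => Primrec.sumInl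
  refine ⟨N, fun n hn kind hash => ⟨Description.code_injective,
    fun R hR => Description.exists_lang_eq_of_isRegular hstr hcls kind hR,
    ⟨_, DescriptionCode.primrec_union.to_comp, Description.exists_union hstr kind⟩,
    ⟨_, (DescriptionCode.primrec_product cls ?_).to_comp,
      Description.exists_mul_regular hstr hcls kind⟩,
    ⟨_, (DescriptionCode.primrec_product cls ?_).to_comp,
      Description.exists_regular_mul hstr hcls kind⟩, hN n hn kind hash⟩⟩
  · exact Primrec.list_cons.comp (hvar n) (Primrec.const _)
  · exact Primrec.list_cons.comp (Primrec.const _) StrTerm.primrec_var
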